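/- Let $\Bbbk$ be an algebraically closed field of characteristic zero, let $\mathfrak g=\mathfrak{sl}_2(\Bbbk)$ with standard basis $\mathrm e,\mathrm f,\mathrm h$ ($[\mathrm e,\mathrm f]=\mathrm h$, $[\mathrm h,\mathrm e]=2\mathrm e$, $[\mathrm h,\mathrm f]=-2\mathrm f$), and let $\hat{\mathfrak g}=\mathfrak g\otimes\Bbbk[t,t^{-1}]$ be its loop algebra. For a function $\varphi:\mathbb Z\to\Bbbk$ and $b=\sum_i b_i t^i\in\Bbbk[t,t^{-1}]$ put $(b\cdot\varphi)(m)=\sum_i b_i\,\varphi(m+i)$. Let $L(\varphi)$ be the unique irreducible quotient of the $\hat{\mathfrak g}$-module induced from the one-dimensional module $\Bbbk v_\varphi$ over the subalgebra $(\Bbbk\mathrm h\oplus\Bbbk\mathrm e)\otimes\Bbbk[t,t^{-1}]$ given by $(\mathrm h\otimes b)v_\varphi=(b\cdot\varphi)(0)\,v_\varphi$ and $(\mathrm e\otimes b)v_\varphi=0$. For $n\ge 0$ let $L(\varphi)_n$ be the weight space of weight $\varphi(0)\frac{\alpha}{2}-n\alpha$, where $\alpha$ is the positive root; that is, $L(\varphi)_n$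 is the eigenspace of $\mathrm h\otimes 1$ on $L(\varphi)$ with eigenvalue $\varphi(0)-2n$. **Theorem.** Let $a:\mathbb Z\to\Bbbk$ be a polynomial function, let $\lambda\in\Bbbk^\times$, and let $\varphi(m)=a(m)\lambda^m$ for $m\in\mathbb Z$. Then $L(\varphi)=\bigoplus_{n\ge 0}L(\varphi)_n$, every $L(\varphi)_n$ is finite-dimensional, and the Poincaré series is $$\sum_{n\ge 0}\dim L(\varphi)_n\,X^n=\begin{cases}\dfrac{1-X^{a+1}}{1-X}&\text{if } a \text{ is constant with value in } \mathbb Z_{+}=\{0,1,2,\dots\},\\[2ex]\dfrac{1}{(1-X)^{\deg a+1}}&\text{otherwise.}\end{cases}$$ -/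

import Mathlib

open scoped TensorProduct

noncomputable section

namespace LoopSl2

universe u

variable (k : Type u) [Field k]

/-- The Lie algebra `𝔤 = sl₂` of traceless `2 × 2` matrices over `k`. -/
abbrev sl2 := LieAlgebra.SpecialLinear.sl (Fin 2) k

/-- The element `e` of the standard basis of `sl₂`. -/
def e : sl2 k := ⟨!![0, 1; 0, 0], by
  change Matrix.trace (!![0, 1; 0, 0] : Matrix (Fin 2) (Fin 2) k) = 0
  simp [Matrix.trace_fin_two]⟩

/-- The element `f` of the standard basis of `sl₂`. -/
def f : sl2 k := ⟨!![0, 0; 1, 0], by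
  change Matrix.trace (!![0, 0; 1, 0] : Matrix (Fin 2) (Fin 2) k) = 0
  simp [Matrix.trace_fin_two]⟩

/-- The element `h` of the standard basis of `sl₂`. -/
def h : sl2 k := ⟨!![1, 0; 0, -1], by
  change Matrix.trace (!![1, 0; 0, -1] : Matrix (Fin 2) (Fin 2) k) = 0
  simp [Matrix.trace_fin_two]⟩

/-- The standard basis satisfies `[e, f] = h`, `[h, e] = 2e`, `[h, f] = -2f`. -/
theorem isSl2Triple [CharZero k] : IsSl2Triple (h k) (e k) (f k) where
  h_ne_zero := by
    intro hh
    have := congrArg (fun x : sl2 k => x.1 0 0) hh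
    simp [h] at this
  lie_e_f := by
    apply Subtype.ext
    simp [h, e, f, LieSubalgebra.coe_bracket, Ring.lie_def]
  lie_h_e_nsmul := by
    apply Subtype.ext
    ext i j
    fin_cases i <;> fin_cases j <;>
      simp [h, e, LieSubalgebra.coe_bracket, Ring.lie_def]
    all_goals norm_num
  lie_h_f_nsmul := by
    apply Subtype.ext
    ext i j
    fin_cases i <;> fin_cases j <;>
      simp [h, f, LieSubalgebra.coe_bracket, Ring.lie_def]
    all_goals norm_num

/-- The loop algebra `k[t, t⁻¹] ⊗ sl₂`, with bracket `[a ⊗ x, b ⊗ y] = ab ⊗ [x, y]`. -/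
abbrev Loop := LaurentPolynomial k ⊗[k] sl2 k

/-- The universal enveloping algebra of the loop algebra; its modules are the modules of the
loop algebra. -/
abbrev ULoop := UniversalEnvelopingAlgebra k (Loop k)

variable {k}

/-- The element `x ⊗ a` of the loop algebra, as an element of the enveloping algebra. -/
def gen (x : sl2 k) (a : LaurentPolynomial k) : ULoop k :=
  UniversalEnvelopingAlgebra.ι k (a ⊗ₜ[k] x)

/-- The action of Laurent polynomials on functions `ℤ → k` in which `t` acts by the shift:
`(t · φ)(m) = φ(m + 1)`. -/
def shiftAct (a : LaurentPolynomial k) (φ : ℤ → k) : ℤ → k :=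
  fun m => a.coeff.sum fun i c => c * φ (m + i)

/-- The exponential function `m ↦ lam ^ m` on `ℤ`. -/
def expMap (lam : kˣ) : ℤ → k := fun m => ((lam ^ m : kˣ) : k)

/-- The left ideal of the enveloping algebra generated by all `e ⊗ a` and all
`h ⊗ a - (a · φ)(0)`. -/
def vermaIdeal (φ : ℤ → k) : Submodule (ULoop k) (ULoop k) :=
  Submodule.span (ULoop k)
    (Set.range (fun a => gen (e k) a) ∪
      Set.range (fun a => gen (h k) a - algebraMap k (ULoop k) (shiftAct a φ 0)))

/-- The universal highest-weight module: the module induced from the one-dimensional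
module `k v` over the subalgebra spanned by all `h ⊗ a` and `e ⊗ a`, on which
`h ⊗ a` acts by `(a · φ)(0)` and `e ⊗ a` by zero. -/
abbrev Verma (φ : ℤ → k) := ULoop k ⧸ vermaIdeal φ

/-- The sum of all proper submodules of the universal module; it is the unique maximal proper
submodule. -/
def maxSubmodule (φ : ℤ → k) : Submodule (ULoop k) (Verma φ) :=
  sSup {N | N ≠ ⊤}

/-- The module `L(φ)`, the unique irreducible quotient of the universal module. -/
abbrev Irred (φ : ℤ → k) := Verma φ ⧸ maxSubmodule φ

/-- The component of degree `n` of `L(φ)`: the weight space of weight `φ(0) α/2 - n α`, that is,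
the eigenspace of `h ⊗ 1` with eigenvalue `φ(0) - 2n`. -/
def component (φ : ℤ → k) (n : ℕ) : Submodule k (Irred φ) :=
  Module.End.eigenspace (Algebra.lsmul k k (Irred φ) (gen (h k) 1)) (φ 0 - 2 * (n : k))

/-- The Poincaré series `∑ dim L(φ)ₙ Xⁿ`. -/
def poincareSeries (φ : ℤ → k) : PowerSeries ℚ :=
  PowerSeries.mk fun n => (Module.finrank k (component φ n) : ℚ)

end LoopSl2

end

noncomputable section

namespace LoopSl2

attribute [local instance] LieRing.ofAssociativeRing

/-! ### Highest weight vectors of the loop algebra and recognition of `L(φ)`. -/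

section HighestWeight

variable {k : Type*} [Field k]

/-! The module `L(φ)` is realized inside a polynomial ring. On the line, `sl₂` acts by `e = ∂`, `h =
-2x∂ + c`, `f = -x²∂ + cx`. Replace the coordinate `x` by a generic series `x₀ + x₁ε + x₂ε² + ⋯` and
the term with `c` by a functional `∑ ξᵢ · [εⁱ]`, `i ≤ N`. This gives an action of `k⟦ε⟧ ⊗ sl₂` on
polynomials in the `xᵢ` by first order operators (`op_comm`), and loops act through the expansion `t
= lam * exp ε`. There `(b · φ)(0)` is a combination of the coefficients of `b` at `ε⁰, …, ε^N`,
where `N = deg a`, with `ξⱼ = j! pⱼ` (`shiftAct_eq_sum_expand`). So the constant `1` is a highest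
weight vector with weight `φ`.

Polynomials in `x₀, …, x_N` are stable, and on them only the expansion modulo `ε^(N+1)` matters;
Laurent polynomials attain every such truncation (`exists_expand_approx`). Hence every `∂/∂xᵢ` with
`i ≤ N` comes from a loop `e ⊗ a`, and differentiation takes any nonzero polynomial down to a
nonzero constant (`exists_rep_eq_one`). The submodule generated by `1` is therefore irreducible and
is `L(φ)` (`nonempty_irred_equiv_span`).

It remains to find this submodule. If `N > 0`, then `ξ_N ≠ 0` forces it to be all of `k[x₀, …, x_N]`
(`X_mul_mem_cyclic`). If `N = 0`, then `f · x₀ⁿ = (ξ₀ - n) x₀ⁿ⁺¹`, and the powers stop exactly when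
`ξ₀` is a natural number. Since `h ⊗ 1` acts on monomials by `ξ₀ - 2 deg`, the Poincaré series
counts monomials by degree. -/

theorem sl2_decomp (y : sl2 k) : y = y.1 0 1 • e k + y.1 1 0 • f k + y.1 0 0 • h k := by
  have ht : y.1 0 0 + y.1 1 1 = 0 := by
    have : Matrix.trace y.1 = 0 := y.2
    simpa [Matrix.trace_fin_two] using this
  apply Subtype.ext
  ext i j
  fin_cases i <;> fin_cases j <;> simp [e, f, h]
  linear_combination ht

theorem lie_e_f : ⁅e k, f k⁆ = h k := by
  apply Subtype.ext
  simp [h, e, f, LieSubalgebra.coe_bracket, Ring.lie_def]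

theorem lie_h_f : ⁅h k, f k⁆ = (-2 : k) • f k := by
  apply Subtype.ext
  ext i j
  fin_cases i <;> fin_cases j <;>
    simp [h, f, LieSubalgebra.coe_bracket, Ring.lie_def]
  norm_num

theorem gen_add (x y : sl2 k) (a : LaurentPolynomial k) :
    gen (x + y) a = gen x a + gen y a := by
  simp [gen, TensorProduct.tmul_add]

theorem gen_smul (c : k) (x : sl2 k) (a : LaurentPolynomial k) :
    gen (c • x) a = c • gen x a := by
  rw [gen, gen, TensorProduct.tmul_smul, map_smul]

theorem gen_mul_gen (x y : sl2 k) (a b : LaurentPolynomial k) :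
    gen x a * gen y b = gen y b * gen x a + gen ⁅x, y⁆ (a * b) := by
  have := (UniversalEnvelopingAlgebra.ι k).map_lie (a ⊗ₜ[k] x) (b ⊗ₜ[k] y : Loop k)
  rw [LieAlgebra.ExtendScalars.bracket_tmul, Ring.lie_def] at this
  rw [gen, gen, gen, this]
  abel

/-- The universal property retracts the enveloping algebra onto the subalgebra generated by the Lie
algebra; by uniqueness the composite with the inclusion is the identity. -/
theorem adjoin_range_ι (L : Type*) [LieRing L] [LieAlgebra k L] :
    Algebra.adjoin k (Set.range (UniversalEnvelopingAlgebra.ι k : L → _)) = ⊤ := by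
  set S := Algebra.adjoin k (Set.range (UniversalEnvelopingAlgebra.ι k : L → _)) with hS
  let g : L →ₗ⁅k⁆ S :=
    { toFun := fun x => ⟨UniversalEnvelopingAlgebra.ι k x,
        Algebra.subset_adjoin (Set.mem_range_self x)⟩
      map_add' := fun x y => Subtype.ext (by simp)
      map_smul' := fun c x => Subtype.ext (by simp)
      map_lie' := fun {x y} => Subtype.ext (by
        simp [Ring.lie_def]) }
  have hcomp : S.val.comp (UniversalEnvelopingAlgebra.lift k g) = AlgHom.id k _ := by
    apply UniversalEnvelopingAlgebra.hom_ext
    ext x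
    simp [g]
  rw [eq_top_iff]
  intro u _
  have := congrArg (fun F => F u) hcomp
  simp only [AlgHom.comp_apply, AlgHom.id_apply] at this
  rw [← this]
  exact Subtype.property _

section Module

variable {M : Type*} [AddCommGroup M] [Module k M] [Module (ULoop k) M]
  [IsScalarTower k (ULoop k) M]

/-- A subspace stable under all `e ⊗ a`, `f ⊗ a` and `h ⊗ a` is stable under the enveloping
algebra. -/
theorem smul_mem_of_gen_stable (S : Submodule k M)
    (he : ∀ a, ∀ m ∈ S, gen (e k) a • m ∈ S) (hf : ∀ a, ∀ m ∈ S, gen (f k) a • m ∈ S)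
    (hh : ∀ a, ∀ m ∈ S, gen (h k) a • m ∈ S) (u : ULoop k) {m : M} (hm : m ∈ S) :
    u • m ∈ S := by
  have hu : u ∈ Algebra.adjoin k (Set.range (UniversalEnvelopingAlgebra.ι k : Loop k → _)) := by
    rw [adjoin_range_ι]; trivial
  induction hu using Algebra.adjoin_induction generalizing m with
  | mem x hx =>
    obtain ⟨y, rfl⟩ := hx
    induction y using TensorProduct.induction_on with
    | zero => simp
    | tmul a y =>
      change gen y a • m ∈ S
      rw [sl2_decomp y, gen_add, gen_add, gen_smul, gen_smul, gen_smul, add_smul, add_smul,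
        smul_assoc, smul_assoc, smul_assoc]
      exact S.add_mem (S.add_mem (S.smul_mem _ (he a m hm)) (S.smul_mem _ (hf a m hm)))
        (S.smul_mem _ (hh a m hm))
    | add y z hy hz =>
      rw [map_add, add_smul]
      exact S.add_mem hy hz
  | algebraMap r =>
    rw [algebraMap_smul]
    exact S.smul_mem r hm
  | add x y _ _ hx hy =>
    rw [add_smul]
    exact S.add_mem (hx hm) (hy hm)
  | mul x y _ _ hx hy =>
    rw [mul_smul]
    exact hx (hy hm)

/-- A vector is a highest weight vector with highest weight `φ` if every `e ⊗ a` annihilates it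
and every `h ⊗ a` acts on it by `(a · φ)(0)`. -/
structure IsHighestWeight (φ : ℤ → k) (v : M) : Prop where
  e_smul : ∀ a, gen (e k) a • v = 0
  h_smul : ∀ a, gen (h k) a • v = shiftAct a φ 0 • v

/-- The span of the vectors obtained from `v` by applying `n` elements of the form `f ⊗ a`. -/
def lowered (v : M) : ℕ → Submodule k M
  | 0 => k ∙ v
  | n + 1 => ⨆ a : LaurentPolynomial k,
      (lowered v n).map (Algebra.lsmul k k M (gen (f k) a))

theorem f_smul_mem_lowered (v : M) {n : ℕ} {w : M} (hw : w ∈ lowered (k := k) v n)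
    (a : LaurentPolynomial k) : gen (f k) a • w ∈ lowered (k := k) v (n + 1) :=
  Submodule.mem_iSup_of_mem a ⟨w, hw, rfl⟩

/-- Induction for the vectors in `lowered v (n + 1)`. -/
theorem lowered_succ_induction {v : M} {n : ℕ} (S : Submodule k M)
    (hS : ∀ a, ∀ w ∈ lowered (k := k) v n, gen (f k) a • w ∈ S) :
    lowered (k := k) v (n + 1) ≤ S := by
  refine iSup_le fun a => ?_
  rintro _ ⟨w, hw, rfl⟩
  exact hS a w hw

variable {φ : ℤ → k} {v : M}

theorem h_smul_mem_lowered (hv : IsHighestWeight φ v) (n : ℕ) (a : LaurentPolynomial k) {w : M}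
    (hw : w ∈ lowered (k := k) v n) : gen (h k) a • w ∈ lowered (k := k) v n := by
  induction n generalizing a w with
  | zero =>
    obtain ⟨c, rfl⟩ := Submodule.mem_span_singleton.1 hw
    rw [smul_comm, hv.h_smul]
    exact Submodule.smul_mem _ _ (Submodule.smul_mem _ _ (Submodule.mem_span_singleton_self v))
  | succ n ih =>
    refine lowered_succ_induction (v := v) ((lowered (k := k) v (n + 1)).comap
      (Algebra.lsmul k k M (gen (h k) a))) (fun b w hw => ?_) hw
    change gen (h k) a • gen (f k) b • w ∈ lowered (k := k) v (n + 1)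
    rw [smul_smul, gen_mul_gen, lie_h_f, gen_smul, add_smul, mul_smul, smul_assoc]
    exact Submodule.add_mem _ (f_smul_mem_lowered v (ih a hw) b)
      (Submodule.smul_mem _ _ (f_smul_mem_lowered v hw _))

theorem e_smul_mem_lowered (hv : IsHighestWeight φ v) (n : ℕ) (a : LaurentPolynomial k) {w : M}
    (hw : w ∈ lowered (k := k) v n) : gen (e k) a • w ∈ ⨆ m, lowered (k := k) v m := by
  cases n with
  | zero =>
    obtain ⟨c, rfl⟩ := Submodule.mem_span_singleton.1 hw
    rw [smul_comm, hv.e_smul, smul_zero]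
    exact Submodule.zero_mem _
  | succ n =>
    -- The induction needs the sharper fact that `e ⊗ a` lowers the number of factors `f ⊗ b` by
    -- exactly one.
    suffices gen (e k) a • w ∈ lowered (k := k) v n from Submodule.mem_iSup_of_mem n this
    induction n generalizing a w with
    | zero =>
      refine lowered_succ_induction (v := v) (n := 0) ((lowered (k := k) v 0).comap
        (Algebra.lsmul k k M (gen (e k) a))) (fun b w hw => ?_) hw
      change gen (e k) a • gen (f k) b • w ∈ lowered (k := k) v 0
      rw [smul_smul, gen_mul_gen, lie_e_f, add_smul, mul_smul]
      refine Submodule.add_mem _ ?_ (h_smul_mem_lowered hv 0 _ hw)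
      obtain ⟨c, rfl⟩ := Submodule.mem_span_singleton.1 hw
      rw [smul_comm _ c, hv.e_smul]
      simp
    | succ n ih =>
      refine lowered_succ_induction (v := v) ((lowered (k := k) v (n + 1)).comap
        (Algebra.lsmul k k M (gen (e k) a))) (fun b w hw => ?_) hw
      change gen (e k) a • gen (f k) b • w ∈ lowered (k := k) v (n + 1)
      rw [smul_smul, gen_mul_gen, lie_e_f, add_smul, mul_smul]
      exact Submodule.add_mem _ (f_smul_mem_lowered v (ih a hw) b)
        (h_smul_mem_lowered hv (n + 1) _ hw)

theorem smul_mem_iSup_lowered (hv : IsHighestWeight φ v) (u : ULoop k) :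
    u • v ∈ ⨆ m, lowered (k := k) v m := by
  have key : ∀ x : ULoop k, (∀ n, ∀ w ∈ lowered (k := k) v n, x • w ∈ ⨆ m, lowered (k := k) v m) →
      ∀ m ∈ ⨆ m, lowered (k := k) v m, x • m ∈ ⨆ m, lowered (k := k) v m := by
    intro x hx m hm
    have : (⨆ m, lowered (k := k) v m) ≤
        (⨆ m, lowered (k := k) v m).comap (Algebra.lsmul k k M x) := iSup_le hx
    exact this hm
  refine smul_mem_of_gen_stable (⨆ m, lowered (k := k) v m)
    (fun a => key _ fun n w hw => e_smul_mem_lowered hv n a hw)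
    (fun a => key _ fun n w hw => Submodule.mem_iSup_of_mem (n + 1) (f_smul_mem_lowered v hw a))
    (fun a => key _ fun n w hw => Submodule.mem_iSup_of_mem n (h_smul_mem_lowered hv n a hw)) u
    (Submodule.mem_iSup_of_mem 0 (Submodule.mem_span_singleton_self v))

theorem shiftAct_one (φ : ℤ → k) : shiftAct 1 φ 0 = φ 0 := by
  rw [shiftAct, AddMonoidAlgebra.one_def, AddMonoidAlgebra.coeff_single, Finsupp.sum_single_index]
  · simp
  · simp

theorem h_one_smul_lowered (hv : IsHighestWeight φ v) (n : ℕ) {w : M}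
    (hw : w ∈ lowered (k := k) v n) : gen (h k) 1 • w = (φ 0 - 2 * (n : k)) • w := by
  induction n generalizing w with
  | zero =>
    obtain ⟨c, rfl⟩ := Submodule.mem_span_singleton.1 hw
    rw [smul_comm, hv.h_smul, shiftAct_one, smul_comm]
    simp
  | succ n ih =>
    refine lowered_succ_induction (Module.End.eigenspace
      (Algebra.lsmul k k M (gen (h k) 1)) (φ 0 - 2 * ((n + 1 : ℕ) : k)))
      (fun b w hw => ?_) hw |> Module.End.mem_eigenspace_iff.1
    rw [Module.End.mem_eigenspace_iff]
    change gen (h k) 1 • gen (f k) b • w = _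
    rw [smul_smul, gen_mul_gen, lie_h_f, gen_smul, add_smul, mul_smul, smul_assoc, ih hw,
      one_mul, smul_comm (gen (f k) b), ← add_smul]
    congr 1
    push_cast
    ring

theorem aeval_h_one_smul (hv : IsHighestWeight φ v) (s : Polynomial k) :
    Polynomial.aeval (gen (h k) 1) s • v = s.eval (φ 0) • v := by
  induction s using Polynomial.induction_on' with
  | add s t hs ht => rw [map_add, add_smul, hs, ht, Polynomial.eval_add, add_smul]
  | monomial n b =>
    rw [← Polynomial.C_mul_X_pow_eq_monomial]
    induction n with
    | zero => simp [algebraMap_smul]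
    | succ n ih =>
      rw [pow_succ, ← mul_assoc, map_mul, mul_smul, Polynomial.aeval_X, hv.h_smul,
        shiftAct_one, smul_comm, ih, smul_smul]
      congr 1
      simp only [Polynomial.eval_mul, Polynomial.eval_C, Polynomial.eval_pow, Polynomial.eval_X]
      ring

/-- A polynomial in `h ⊗ 1` that is nonzero at the highest weight maps a given vector of a highest
weight module to the highest weight line. -/
theorem exists_polynomial_smul [CharZero k] (hv : IsHighestWeight φ v) (u : ULoop k) :
    ∃ q : Polynomial k, q.eval (φ 0) ≠ 0 ∧
      ∃ c : k, Polynomial.aeval (gen (h k) 1) q • u • v = c • v := by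
  refine Submodule.iSup_induction (lowered (k := k) v) (motive := fun w =>
    ∃ q : Polynomial k, q.eval (φ 0) ≠ 0 ∧
      ∃ c : k, Polynomial.aeval (gen (h k) 1) q • w = c • v) (smul_mem_iSup_lowered hv u) ?_ ?_ ?_
  · intro n w hw
    cases n with
    | zero =>
      obtain ⟨c, rfl⟩ := Submodule.mem_span_singleton.1 hw
      exact ⟨1, by simp, c, by simp⟩
    | succ n =>
      -- This linear factor kills the weight space of depth `n + 1`; at `φ 0` its value is `2(n +
      -- 1)`, nonzero in characteristic zero.
      refine ⟨Polynomial.X - Polynomial.C (φ 0 - 2 * ((n + 1 : ℕ) : k)), ?_, 0, ?_⟩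
      · simp only [Polynomial.eval_sub, Polynomial.eval_X, Polynomial.eval_C, sub_sub_cancel]
        exact mul_ne_zero two_ne_zero (Nat.cast_ne_zero.2 (Nat.succ_ne_zero n))
      · rw [map_sub, Polynomial.aeval_X, Polynomial.aeval_C, sub_smul, algebraMap_smul,
          h_one_smul_lowered hv _ hw, sub_self, zero_smul]
  · exact ⟨1, by simp, 0, by simp⟩
  · rintro x y ⟨q, hq, c, hc⟩ ⟨r, hr, d, hd⟩
    refine ⟨q * r, by simp [hq, hr], c * r.eval (φ 0) + d * q.eval (φ 0), ?_⟩
    rw [smul_add, map_mul, mul_smul _ _ y, hd, ← map_mul, mul_comm q r, map_mul, mul_smul, hc,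
      smul_comm, aeval_h_one_smul hv, smul_comm _ d, aeval_h_one_smul hv,
      smul_smul, smul_smul, add_smul]

end Module

theorem isHighestWeight_mk (φ : ℤ → k) :
    IsHighestWeight φ ((vermaIdeal φ).mkQ 1 : Verma φ) where
  e_smul a := by
    rw [← map_smul, smul_eq_mul, mul_one]
    exact (Submodule.Quotient.mk_eq_zero _).2 (Submodule.subset_span (Or.inl ⟨a, rfl⟩))
  h_smul a := by
    rw [← sub_eq_zero, ← algebraMap_smul (ULoop k), ← sub_smul, ← map_smul, smul_eq_mul, mul_one]
    exact (Submodule.Quotient.mk_eq_zero _).2 (Submodule.subset_span (Or.inr ⟨a, rfl⟩))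

/-- If every nonzero vector of the module generated by a nonzero highest weight vector `v`
generates `v`, then that module is a copy of `L(φ)`. -/
theorem nonempty_irred_equiv_span [CharZero k] {M : Type*} [AddCommGroup M] [Module k M]
    [Module (ULoop k) M] [IsScalarTower k (ULoop k) M] {φ : ℤ → k} {v : M}
    (hv : IsHighestWeight φ v) (hv0 : v ≠ 0)
    (hirr : ∀ w ∈ ULoop k ∙ v, w ≠ 0 → v ∈ ULoop k ∙ w) :
    Nonempty (Irred φ ≃ₗ[ULoop k] (ULoop k ∙ v : Submodule (ULoop k) M)) := by
  have hle : vermaIdeal φ ≤ LinearMap.ker (LinearMap.toSpanSingleton (ULoop k) M v) := by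
    refine Submodule.span_le.2 ?_
    rintro _ (⟨a, rfl⟩ | ⟨a, rfl⟩)
    · simp [hv.e_smul]
    · simp [sub_smul, hv.h_smul, algebraMap_smul]
  let ψ : Verma φ →ₗ[ULoop k] M :=
    (vermaIdeal φ).liftQ (LinearMap.toSpanSingleton (ULoop k) M v) hle
  set v₀ : Verma φ := (vermaIdeal φ).mkQ 1 with hv₀
  have hψ : ψ v₀ = v := by simp [ψ, hv₀]
  have hgen : ∀ x : Verma φ, ∃ u : ULoop k, x = u • v₀ := by
    intro x
    obtain ⟨u, rfl⟩ := (vermaIdeal φ).mkQ_surjective x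
    exact ⟨u, by rw [hv₀, ← map_smul, smul_eq_mul, mul_one]⟩
  have hrange : LinearMap.range ψ = ULoop k ∙ v := by
    rw [Submodule.range_liftQ, LinearMap.range_toSpanSingleton]
  have hker : maxSubmodule φ = LinearMap.ker ψ := by
    apply le_antisymm
    · refine sSup_le fun N hN => ?_
      -- A submodule not inside the kernel is shown to contain `v₀`: its image generates `v`, and a
      -- polynomial in `h ⊗ 1` removes the lower weight parts of a lift of `v`.
      by_contra hN'
      obtain ⟨n, hn, hn0⟩ := SetLike.not_le_iff_exists.1 hN'
      have hmem : ψ n ∈ ULoop k ∙ v := hrange ▸ LinearMap.mem_range_self ψ n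
      obtain ⟨u, hu⟩ := Submodule.mem_span_singleton.1 (hirr _ hmem hn0)
      obtain ⟨u', hu'⟩ := hgen (u • n)
      obtain ⟨q, hq, c, hc⟩ := exists_polynomial_smul (isHighestWeight_mk φ) u'
      rw [← hv₀, ← hu'] at hc
      -- Applying `ψ` to `hc` gives `q(φ 0) v = c v`, and the left side is nonzero.
      have hc0 : c ≠ 0 := by
        rintro rfl
        have h1 := congrArg ψ hc
        rw [map_smul, map_smul, hu, zero_smul, map_zero] at h1
        rw [aeval_h_one_smul hv] at h1
        exact (smul_ne_zero hq hv0) h1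
      have hv₀N : v₀ ∈ N := by
        have h2 : c • v₀ ∈ N := hc ▸ N.smul_mem _ (N.smul_mem _ hn)
        have h3 := N.smul_mem (algebraMap k (ULoop k) c⁻¹) h2
        rwa [algebraMap_smul, smul_smul, inv_mul_cancel₀ hc0, one_smul] at h3
      refine hN (eq_top_iff.2 fun x _ => ?_)
      obtain ⟨u, rfl⟩ := hgen x
      exact N.smul_mem u hv₀N
    · refine le_sSup fun htop => hv0 ?_
      have : v₀ ∈ LinearMap.ker ψ := htop ▸ Submodule.mem_top
      rw [← hψ]
      exact this
  exact ⟨(Submodule.quotEquivOfEq _ _ hker).trans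
    (ψ.quotKerEquivRange.trans (LinearEquiv.ofEq _ _ hrange))⟩

end HighestWeight

/-! ### Eigenspaces of an operator diagonal in a given basis. -/

section Eigenbasis

variable {k : Type*} [Field k] {V ι : Type*} [AddCommGroup V] [Module k V]
  (b : Module.Basis ι k V) (T : Module.End k V) (d : ι → ℕ) (μ : k)

theorem eigenspace_eq_span_of_basis [CharZero k] (hT : ∀ i, T (b i) = (μ - 2 * (d i : k)) • b i)
    (n : ℕ) : T.eigenspace (μ - 2 * (n : k)) = Submodule.span k (b '' {i | d i = n}) := by
  apply le_antisymm
  · intro x hx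
    rw [Module.End.mem_eigenspace_iff] at hx
    rw [Module.Basis.mem_span_image]
    intro i hi
    have hrepr : ∀ y, b.repr (T y) i = (μ - 2 * (d i : k)) * b.repr y i := by
      intro y
      have : (Finsupp.lapply i ∘ₗ b.repr.toLinearMap ∘ₗ T) =
          (μ - 2 * (d i : k)) • (Finsupp.lapply i ∘ₗ b.repr.toLinearMap) := by
        refine b.ext fun j => ?_
        by_cases hij : j = i
        · subst hij; simp [hT]
        · simp [hT, Finsupp.single_eq_of_ne' hij]
      exact LinearMap.congr_fun this y
    have h1 := hrepr x
    rw [hx, map_smul, Finsupp.smul_apply, smul_eq_mul] at h1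
    have h2 := mul_right_cancel₀ (Finsupp.mem_support_iff.1 hi) h1
    have h3 : (n : k) = d i := by
      have : (2 : k) * n = 2 * d i := by linear_combination -h2
      exact mul_left_cancel₀ two_ne_zero this
    exact (Nat.cast_injective h3).symm
  · rw [Submodule.span_le]
    rintro _ ⟨i, rfl, rfl⟩
    exact Module.End.mem_eigenspace_iff.2 (hT i)

theorem finrank_eigenspace_of_basis [CharZero k]
    (hT : ∀ i, T (b i) = (μ - 2 * (d i : k)) • b i) (n : ℕ) :
    Module.finrank k (T.eigenspace (μ - 2 * (n : k))) = {i | d i = n}.ncard := by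
  rw [eigenspace_eq_span_of_basis b T d μ hT, ← Set.ncard_image_of_injective _ b.injective,
    ← Nat.card_coe_set_eq]
  have hli : LinearIndependent k ((↑) : (b '' {i | d i = n}) → V) :=
    b.linearIndependent.linearIndepOn_id.mono (Set.image_subset_range _ _)
  have := Module.finrank_eq_nat_card_basis (Module.Basis.span hli)
  rwa [Subtype.range_coe] at this

theorem isInternal_eigenspace_of_basis [CharZero k]
    (hT : ∀ i, T (b i) = (μ - 2 * (d i : k)) • b i) :
    DirectSum.IsInternal fun n : ℕ => T.eigenspace (μ - 2 * (n : k)) := by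
  rw [DirectSum.isInternal_submodule_iff_iSupIndep_and_iSup_eq_top]
  constructor
  · refine T.eigenspaces_iSupIndep.comp (f := fun n : ℕ => μ - 2 * (n : k)) fun m n hmn => ?_
    have : (2 : k) * m = 2 * n := by linear_combination -hmn
    exact Nat.cast_injective (mul_left_cancel₀ two_ne_zero this)
  · rw [eq_top_iff, ← b.span_eq, Submodule.span_le]
    rintro _ ⟨i, rfl⟩
    exact Submodule.mem_iSup_of_mem (d i) (Module.End.mem_eigenspace_iff.2 (hT i))

end Eigenbasis

/-! ### The action of `k⟦ε⟧ ⊗ sl₂` by differential operators. -/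

section Model

variable {k : Type*} [Field k]

/-- The generic power series, whose coefficients are the variables. -/
def generic (k : Type*) [Field k] : PowerSeries (MvPolynomial ℕ k) :=
  PowerSeries.mk MvPolynomial.X

/-- Power series over `k` as power series with constant polynomial coefficients. -/
def const : PowerSeries k →+* PowerSeries (MvPolynomial ℕ k) :=
  PowerSeries.map MvPolynomial.C

/-- The polynomial vector field whose components are the coefficients of `v`. -/
def field (v : PowerSeries (MvPolynomial ℕ k)) :
    Derivation k (MvPolynomial ℕ k) (MvPolynomial ℕ k) :=
  MvPolynomial.mkDerivation k fun i => PowerSeries.coeff i v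

@[simp]
theorem field_X (v : PowerSeries (MvPolynomial ℕ k)) (i : ℕ) :
    field v (MvPolynomial.X i) = PowerSeries.coeff i v :=
  MvPolynomial.mkDerivation_X _ _ _

theorem field_add (u v : PowerSeries (MvPolynomial ℕ k)) : field (u + v) = field u + field v :=
  MvPolynomial.derivation_ext fun i => by simp

theorem field_const_smul (c : k) (v : PowerSeries (MvPolynomial ℕ k)) :
    field (MvPolynomial.C (σ := ℕ) c • v) = c • field v :=
  MvPolynomial.derivation_ext fun i => by simp [MvPolynomial.smul_eq_C_mul]

/-- The coefficientwise extension of a derivation of polynomials to power series. -/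
def coeffwise (D : Derivation k (MvPolynomial ℕ k) (MvPolynomial ℕ k)) :
    Derivation k (PowerSeries (MvPolynomial ℕ k)) (PowerSeries (MvPolynomial ℕ k)) :=
  Derivation.mk'
    { toFun := fun v => PowerSeries.mk fun i => D (PowerSeries.coeff i v)
      map_add' := fun u v => by ext1 i; simp
      map_smul' := fun c v => by ext1 i; simp }
    fun u v => by
      ext1 i
      simp only [LinearMap.coe_mk, AddHom.coe_mk, PowerSeries.coeff_mk, PowerSeries.coeff_mul,
        map_sum, Derivation.leibniz, smul_eq_mul, map_add, Finset.sum_add_distrib]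
      congr 1
      rw [← Finset.Nat.sum_antidiagonal_swap]
      rfl

@[simp]
theorem coeff_coeffwise (D : Derivation k (MvPolynomial ℕ k) (MvPolynomial ℕ k))
    (v : PowerSeries (MvPolynomial ℕ k)) (i : ℕ) :
    PowerSeries.coeff i (coeffwise D v) = D (PowerSeries.coeff i v) :=
  PowerSeries.coeff_mk i fun i => D (PowerSeries.coeff i v)

@[simp]
theorem coeffwise_const (D : Derivation k (MvPolynomial ℕ k) (MvPolynomial ℕ k))
    (a : PowerSeries k) : coeffwise D (const a) = 0 := by
  ext1 i
  simp [const]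

@[simp]
theorem coeffwise_field_generic (v : PowerSeries (MvPolynomial ℕ k)) :
    coeffwise (field v) (generic k) = v := by
  ext1 i
  simp [generic]

/-- The commutator of two derivations is a derivation, so it is determined by its values on the
variables, which are the coefficients of the series on the right. -/
theorem field_comm (u v : PowerSeries (MvPolynomial ℕ k)) (w : MvPolynomial ℕ k) :
    field u (field v w) - field v (field u w) =
      field (coeffwise (field u) v - coeffwise (field v) u) w := by
  rw [← Derivation.commutator_apply]
  congr 1
  exact MvPolynomial.derivation_ext fun i => by simp [Derivation.commutator_apply]

variable (N : ℕ) (ξ : ℕ → k)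

/-- The functional `v ↦ ∑ ξᵢ vᵢ`, over `i ≤ N`, on power series. -/
def pairing : PowerSeries (MvPolynomial ℕ k) →ₗ[MvPolynomial ℕ k] MvPolynomial ℕ k :=
  ∑ i ∈ Finset.range (N + 1), MvPolynomial.C (σ := ℕ) (ξ i) • PowerSeries.coeff i

theorem pairing_apply (v : PowerSeries (MvPolynomial ℕ k)) :
    pairing N ξ v =
      ∑ i ∈ Finset.range (N + 1), MvPolynomial.C (σ := ℕ) (ξ i) * PowerSeries.coeff i v := by
  simp [pairing]

theorem derivation_pairing (D : Derivation k (MvPolynomial ℕ k) (MvPolynomial ℕ k))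
    (v : PowerSeries (MvPolynomial ℕ k)) : D (pairing N ξ v) = pairing N ξ (coeffwise D v) := by
  simp [pairing_apply]

/-- The vector field by which `e ⊗ a.1 + h ⊗ a.2.1 + f ⊗ a.2.2` acts, written as a power series. -/
def vec (a : PowerSeries k × PowerSeries k × PowerSeries k) : PowerSeries (MvPolynomial ℕ k) :=
  const a.1 - 2 * const a.2.1 * generic k - const a.2.2 * generic k ^ 2

/-- The power series whose pairing is the zeroth order part of the action of
`e ⊗ a.1 + h ⊗ a.2.1 + f ⊗ a.2.2`. -/
def pot (a : PowerSeries k × PowerSeries k × PowerSeries k) : PowerSeries (MvPolynomial ℕ k) :=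
  const a.2.1 + const a.2.2 * generic k

theorem const_smul (c : k) (a : PowerSeries k) :
    const (c • a) = MvPolynomial.C (σ := ℕ) c • const a := by
  ext1 i
  simp [const]

/-- The action of `e ⊗ a.1 + h ⊗ a.2.1 + f ⊗ a.2.2` by first order differential operators on
polynomials. -/
def op : (PowerSeries k × PowerSeries k × PowerSeries k) →ₗ[k] Module.End k (MvPolynomial ℕ k) where
  toFun a := (field (vec a)).toLinearMap + LinearMap.mulLeft k (pairing N ξ (pot a))
  map_add' a b := by
    have h1 : vec (a + b) = vec a + vec b := by
      simp only [vec, Prod.fst_add, Prod.snd_add, map_add]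
      ring
    have h2 : pot (a + b) = pot a + pot b := by
      simp only [pot, Prod.fst_add, Prod.snd_add, map_add]
      ring
    refine LinearMap.ext fun w => ?_
    simp only [h1, h2, field_add, map_add, LinearMap.add_apply, LinearMap.mulLeft_apply,
      Derivation.coe_add_linearMap]
    ring
  map_smul' c a := by
    have h1 : vec (c • a) = MvPolynomial.C (σ := ℕ) c • vec a := by
      simp only [vec, Prod.smul_fst, Prod.smul_snd, const_smul, smul_sub, smul_mul_assoc,
        mul_smul_comm]
    have h2 : pot (c • a) = MvPolynomial.C (σ := ℕ) c • pot a := by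
      simp only [pot, Prod.smul_fst, Prod.smul_snd, const_smul, smul_add, smul_mul_assoc]
    refine LinearMap.ext fun w => ?_
    simp only [h1, h2, field_const_smul, map_smul, LinearMap.add_apply, LinearMap.mulLeft_apply,
      RingHom.id_apply, LinearMap.smul_apply, smul_add]
    simp [MvPolynomial.smul_eq_C_mul, mul_assoc]

theorem op_apply (a : PowerSeries k × PowerSeries k × PowerSeries k) (w : MvPolynomial ℕ k) :
    op N ξ a w = field (vec a) w + pairing N ξ (pot a) * w :=
  rfl

/-- Products of zeroth order parts cancel in the commutator. What remains is the commutator of the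
vector fields and each field applied to the other potential; both match the bracket of `sl₂` written
in `(e, h, f)` coordinates. -/
theorem op_comm (a b : PowerSeries k × PowerSeries k × PowerSeries k) (w : MvPolynomial ℕ k) :
    op N ξ a (op N ξ b w) - op N ξ b (op N ξ a w) =
      op N ξ (2 * (a.2.1 * b.1 - a.1 * b.2.1), a.1 * b.2.2 - b.1 * a.2.2,
        2 * (a.2.2 * b.2.1 - a.2.1 * b.2.2)) w := by
  obtain ⟨a₁, a₂, a₃⟩ := a
  obtain ⟨b₁, b₂, b₃⟩ := b
  have hD : ∀ (u : PowerSeries (MvPolynomial ℕ k)) (b₁ b₂ b₃ : PowerSeries k),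
      coeffwise (field u) (vec (b₁, b₂, b₃)) =
        - (2 * const b₂ * u) - 2 * const b₃ * generic k * u := by
    intro u b₁ b₂ b₃
    -- Writing `2` as a constant series lets `coeffwise_const` annihilate it.
    have h2 : (2 : PowerSeries (MvPolynomial ℕ k)) = const 2 := (map_ofNat const 2).symm
    simp only [vec, map_sub, coeffwise_const, Derivation.leibniz, h2, coeffwise_field_generic,
      pow_two, smul_eq_mul, mul_zero, add_zero, ← map_mul]
    simp only [map_mul]
    rw [← h2]
    ring
  have hP : ∀ (u : PowerSeries (MvPolynomial ℕ k)) (b₁ b₂ b₃ : PowerSeries k),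
      field u (pairing N ξ (pot (b₁, b₂, b₃))) = pairing N ξ (const b₃ * u) := by
    intro u b₁ b₂ b₃
    simp [derivation_pairing, pot]
  have h1 : coeffwise (field (vec (a₁, a₂, a₃))) (vec (b₁, b₂, b₃)) -
      coeffwise (field (vec (b₁, b₂, b₃))) (vec (a₁, a₂, a₃)) =
      vec (2 * (a₂ * b₁ - a₁ * b₂), a₁ * b₃ - b₁ * a₃, 2 * (a₃ * b₂ - a₂ * b₃)) := by
    rw [hD, hD]
    simp only [vec, map_mul, map_sub, map_ofNat]
    ring
  have h2 : field (vec (a₁, a₂, a₃)) (pairing N ξ (pot (b₁, b₂, b₃))) -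
      field (vec (b₁, b₂, b₃)) (pairing N ξ (pot (a₁, a₂, a₃))) =
      pairing N ξ (pot (2 * (a₂ * b₁ - a₁ * b₂), a₁ * b₃ - b₁ * a₃,
        2 * (a₃ * b₂ - a₂ * b₃))) := by
    rw [hP, hP, ← map_sub]
    congr 1
    simp only [vec, pot, map_mul, map_sub, map_ofNat]
    ring
  have h3 := field_comm (vec (a₁, a₂, a₃)) (vec (b₁, b₂, b₃)) w
  simp only [op_apply, map_add, Derivation.leibniz, smul_eq_mul]
  rw [← h1, ← h2, ← h3]
  ring

/-- The coordinates of an element of `k⟦X⟧ ⊗ sl₂` obtained from a loop by a homomorphism of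
coefficient algebras. -/
def coords (τ : LaurentPolynomial k →ₐ[k] PowerSeries k) :
    Loop k →ₗ[k] PowerSeries k × PowerSeries k × PowerSeries k :=
  TensorProduct.lift (LinearMap.mk₂ k
    (fun a y => (y.1 0 1 • τ a, y.1 0 0 • τ a, y.1 1 0 • τ a))
    (fun a b y => by simp) (fun c a y => by simp [smul_comm c])
    (fun a y z => by simp [add_smul]) (fun c a y => by simp [mul_smul]))

@[simp]
theorem coords_tmul (τ : LaurentPolynomial k →ₐ[k] PowerSeries k) (a : LaurentPolynomial k)
    (y : sl2 k) : coords τ (a ⊗ₜ[k] y) = (y.1 0 1 • τ a, y.1 0 0 • τ a, y.1 1 0 • τ a) :=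
  rfl

/-- The representation of the loop algebra by first order differential operators. -/
def loopRep (τ : LaurentPolynomial k →ₐ[k] PowerSeries k) :
    Loop k →ₗ⁅k⁆ Module.End k (MvPolynomial ℕ k) :=
  { op N ξ ∘ₗ coords τ with
    map_lie' := by
      intro x y
      change op N ξ (coords τ ⁅x, y⁆) = ⁅op N ξ (coords τ x), op N ξ (coords τ y)⁆
      induction x using TensorProduct.induction_on with
      | zero => rw [show ⁅(0 : Loop k), y⁆ = 0 from zero_lie y]; simp
      | add x x' hx hx' =>
        rw [show ⁅(x + x' : Loop k), y⁆ = ⁅x, y⁆ + ⁅x', y⁆ from add_lie x x' y]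
        simp only [map_add, add_lie, hx, hx']
      | tmul a x =>
        induction y using TensorProduct.induction_on with
        | zero =>
          rw [show ⁅(a ⊗ₜ[k] x : Loop k), (0 : Loop k)⁆ = 0 from lie_zero (a ⊗ₜ[k] x : Loop k)]
          simp
        | add y y' hy hy' =>
          rw [show ⁅(a ⊗ₜ[k] x : Loop k), (y + y' : Loop k)⁆ =
            ⁅(a ⊗ₜ[k] x : Loop k), y⁆ + ⁅(a ⊗ₜ[k] x : Loop k), y'⁆ from
              lie_add (a ⊗ₜ[k] x : Loop k) y y']
          simp only [map_add, lie_add, hy, hy']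
        | tmul b y =>
          have hx : x.1 1 1 = - x.1 0 0 := by
            have : Matrix.trace x.1 = 0 := x.2
            rw [Matrix.trace_fin_two] at this
            linear_combination this
          have hy : y.1 1 1 = - y.1 0 0 := by
            have : Matrix.trace y.1 = 0 := y.2
            rw [Matrix.trace_fin_two] at this
            linear_combination this
          refine LinearMap.ext fun w => ?_
          rw [Ring.lie_def, LinearMap.sub_apply, Module.End.mul_apply, Module.End.mul_apply,
            op_comm, LieAlgebra.ExtendScalars.bracket_tmul, coords_tmul, coords_tmul, coords_tmul]
          congr 2
          simp only [LieAlgebra.SpecialLinear.sl_bracket, Matrix.sub_apply, Matrix.mul_apply,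
            Fin.sum_univ_two, hx, hy, map_mul, PowerSeries.smul_eq_C_mul, map_sub, map_add, map_neg]
          refine Prod.ext ?_ (Prod.ext ?_ ?_) <;> simp only <;> ring }

/-- The representation of the enveloping algebra by differential operators. -/
def rep (τ : LaurentPolynomial k →ₐ[k] PowerSeries k) :
    ULoop k →ₐ[k] Module.End k (MvPolynomial ℕ k) :=
  UniversalEnvelopingAlgebra.lift k (loopRep N ξ τ)

theorem rep_gen (τ : LaurentPolynomial k →ₐ[k] PowerSeries k) (x : sl2 k)
    (a : LaurentPolynomial k) :
    rep N ξ τ (gen x a) = op N ξ (x.1 0 1 • τ a, x.1 0 0 • τ a, x.1 1 0 • τ a) := by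
  rw [rep, gen, UniversalEnvelopingAlgebra.lift_ι_apply]
  rfl

theorem rep_e (τ : LaurentPolynomial k →ₐ[k] PowerSeries k) (a : LaurentPolynomial k) :
    rep N ξ τ (gen (e k) a) = op N ξ (τ a, 0, 0) := by
  simp [rep_gen, e]

theorem rep_h (τ : LaurentPolynomial k →ₐ[k] PowerSeries k) (a : LaurentPolynomial k) :
    rep N ξ τ (gen (h k) a) = op N ξ (0, τ a, 0) := by
  simp [rep_gen, h]

theorem rep_f (τ : LaurentPolynomial k →ₐ[k] PowerSeries k) (a : LaurentPolynomial k) :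
    rep N ξ τ (gen (f k) a) = op N ξ (0, 0, τ a) := by
  simp [rep_gen, f]

end Model

/-! ### Expansion of Laurent polynomials at `t = lam * exp ε`. -/

section Expansion

variable {k : Type*} [Field k] [CharZero k]

/-- The expansion of Laurent polynomials as power series in `ε` given by `t = lam * exp ε`. -/
def expand (lam : kˣ) : LaurentPolynomial k →ₐ[k] PowerSeries k :=
  AddMonoidAlgebra.lift k (PowerSeries k) ℤ
    { toFun := fun n => ((lam ^ n.toAdd : kˣ) : k) •
        PowerSeries.rescale ((n.toAdd : ℤ) : k) (PowerSeries.exp k)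
      map_one' := by
        ext n
        cases n <;> simp
      map_mul' := fun m n => by
        rw [smul_mul_smul_comm, PowerSeries.exp_mul_exp_eq_exp_add, toAdd_mul, zpow_add]
        push_cast
        rfl }

theorem expand_single (lam : kˣ) (i : ℤ) (c : k) :
    expand lam (AddMonoidAlgebra.single i c) =
      c • ((lam ^ i : kˣ) : k) • PowerSeries.rescale (i : k) (PowerSeries.exp k) :=
  AddMonoidAlgebra.lift_single _ _ _

/-- The coefficient of `εʲ` in the expansion of `tⁱ` is `lamⁱ iʲ / j!`, so the weight `j! pⱼ`
recovers the term `pⱼ iʲ lamⁱ` of `φ(i)`. -/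
theorem shiftAct_eq_sum_expand (p : Polynomial k) (lam : kˣ) (φ : ℤ → k)
    (hφ : ∀ m, φ m = p.eval (m : k) * expMap lam m) (b : LaurentPolynomial k) :
    shiftAct b φ 0 = ∑ j ∈ Finset.range (p.natDegree + 1),
      (j.factorial : k) * p.coeff j * PowerSeries.coeff j (expand lam b) := by
  induction b using AddMonoidAlgebra.induction_linear with
  | zero => simp [shiftAct]
  | add x y hx hy =>
    have : shiftAct (x + y) φ 0 = shiftAct x φ 0 + shiftAct y φ 0 := by
      rw [shiftAct, AddMonoidAlgebra.coeff_add]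
      exact Finsupp.sum_add_index' (by simp) (fun i c d => by ring)
    rw [this, hx, hy, ← Finset.sum_add_distrib]
    exact Finset.sum_congr rfl fun j _ => by rw [map_add, map_add]; ring
  | single i c =>
    rw [shiftAct, AddMonoidAlgebra.coeff_single, Finsupp.sum_single_index (by simp), zero_add, hφ,
      expand_single, Polynomial.eval_eq_sum_range, Finset.sum_mul, Finset.mul_sum]
    refine Finset.sum_congr rfl fun j _ => ?_
    have hj : (j.factorial : k) ≠ 0 := Nat.cast_ne_zero.2 j.factorial_ne_zero
    simp only [map_smul, smul_eq_mul, PowerSeries.coeff_rescale, PowerSeries.coeff_exp, expMap,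
      map_div₀, map_one, map_natCast]
    field_simp

/-- Powers of `lam⁻¹ t - 1`, which expands to `exp ε - 1 = ε + ⋯`, correct an approximation one
coefficient at a time. -/
theorem exists_expand_approx (lam : kˣ) (g : PowerSeries k) (K : ℕ) :
    ∃ a, PowerSeries.X ^ K ∣ g - expand lam a := by
  induction K with
  | zero => exact ⟨0, by simp⟩
  | succ K ih =>
    obtain ⟨a, q, hq⟩ := ih
    obtain ⟨r, hr⟩ : PowerSeries.X ∣ PowerSeries.exp k - 1 := by
      rw [PowerSeries.X_dvd_iff]; simp
    have hr0 : PowerSeries.constantCoeff r = 1 := by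
      have := congrArg (PowerSeries.coeff 1) hr
      rw [show (1 : ℕ) = 0 + 1 from rfl, PowerSeries.coeff_succ_X_mul] at this
      simpa [PowerSeries.coeff_exp, PowerSeries.coeff_one] using this.symm
    let s : LaurentPolynomial k := AddMonoidAlgebra.single 1 ((lam⁻¹ : kˣ) : k) - 1
    have hs : expand lam s = PowerSeries.X * r := by
      rw [map_sub, map_one, expand_single, ← hr]
      simp [smul_smul]
    obtain ⟨q', hq'⟩ : PowerSeries.X ∣ q - PowerSeries.C (PowerSeries.constantCoeff q) * r ^ K := by
      rw [PowerSeries.X_dvd_iff]; simp [hr0]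
    refine ⟨a + PowerSeries.constantCoeff q • s ^ K, q', ?_⟩
    rw [map_add, map_smul, map_pow, hs, ← sub_sub, hq, PowerSeries.smul_eq_C_mul, mul_pow, pow_succ,
      mul_assoc _ _ q', ← hq']
    ring

end Expansion

/-! ### Derivatives and supports of polynomials. -/

section Polynomials

variable {k : Type*} [Field k]

theorem mem_supported_iff_mem_restrictSupport {σ : Type*} (s : Set σ) (w : MvPolynomial σ k) :
    w ∈ MvPolynomial.supported k s ↔
      w ∈ MvPolynomial.restrictSupport k {m : σ →₀ ℕ | ↑m.support ⊆ s} := by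
  rw [MvPolynomial.mem_supported, MvPolynomial.mem_restrictSupport_iff]
  constructor
  · intro hw m hm i hi
    exact hw ((MvPolynomial.mem_vars_iff_mem_support i).2 ⟨m, hm, hi⟩)
  · intro hw i hi
    obtain ⟨m, hm, hi⟩ := (MvPolynomial.mem_vars_iff_mem_support i).1 hi
    exact hw hm hi

theorem derivation_mem_supported {σ : Type*} {s : Set σ}
    (D : Derivation k (MvPolynomial σ k) (MvPolynomial σ k))
    (hD : ∀ i ∈ s, D (MvPolynomial.X i) ∈ MvPolynomial.supported k s) {w : MvPolynomial σ k}
    (hw : w ∈ MvPolynomial.supported k s) : D w ∈ MvPolynomial.supported k s := by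
  rw [MvPolynomial.supported_eq_adjoin_X] at hw
  induction hw using Algebra.adjoin_induction with
  | mem x hx => obtain ⟨i, hi, rfl⟩ := hx; exact hD i hi
  | algebraMap r => simp
  | add x y _ _ hx hy => rw [map_add]; exact add_mem hx hy
  | mul x y hx' hy' hx hy =>
    rw [Derivation.leibniz, smul_eq_mul, smul_eq_mul]
    exact add_mem (mul_mem hx' hy) (mul_mem hy' hx)

theorem eq_C_of_pderiv_eq_zero [CharZero k] {σ : Type*} {w : MvPolynomial σ k}
    (hw : ∀ i, MvPolynomial.pderiv i w = 0) : w = MvPolynomial.C (MvPolynomial.coeff 0 w) := by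
  classical
  ext m
  rw [MvPolynomial.coeff_C]
  split_ifs with hm
  · rw [hm]
  · obtain ⟨i, hi⟩ := Finsupp.ne_iff.1 (Ne.symm hm)
    have h1 := MvPolynomial.coeff_pderiv w (m - Finsupp.single i 1) (i := i)
    have h2 : m - Finsupp.single i 1 + Finsupp.single i 1 = m := by
      refine tsub_add_cancel_of_le (Finsupp.single_le_iff.2 ?_)
      exact Nat.one_le_iff_ne_zero.2 hi
    rw [hw i, MvPolynomial.coeff_zero, h2] at h1
    refine (mul_eq_zero.1 h1.symm).resolve_right ?_
    exact Nat.cast_add_one_ne_zero _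

theorem totalDegree_pderiv_lt {σ : Type*} {w : MvPolynomial σ k} {i : σ}
    (hw : MvPolynomial.pderiv i w ≠ 0) :
    (MvPolynomial.pderiv i w).totalDegree < w.totalDegree := by
  have key : ∀ m ∈ (MvPolynomial.pderiv i w).support, (m.sum fun _ e => e) < w.totalDegree := by
    intro m hm
    rw [MvPolynomial.mem_support_iff, MvPolynomial.coeff_pderiv] at hm
    have h1 := MvPolynomial.le_totalDegree (MvPolynomial.mem_support_iff.2 (left_ne_zero_of_mul hm))
    rw [Finsupp.sum_add_index' (by simp) (by simp), Finsupp.sum_single_index rfl] at h1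
    omega
  obtain ⟨m, hm⟩ := MvPolynomial.support_nonempty.2 hw
  rw [MvPolynomial.totalDegree, Finset.sup_lt_iff (bot_lt_of_lt (key m hm))]
  exact key

theorem exists_iterate_pderiv_eq_zero {σ : Type*} (i : σ) (w : MvPolynomial σ k) :
    ∃ n, (MvPolynomial.pderiv (R := k) i)^[n] w = 0 := by
  induction hd : w.totalDegree using Nat.strong_induction_on generalizing w with
  | _ d ih =>
    by_cases h0 : MvPolynomial.pderiv i w = 0
    · exact ⟨1, h0⟩
    · obtain ⟨n, hn⟩ := ih _ (hd ▸ totalDegree_pderiv_lt h0) _ rfl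
      exact ⟨n + 1, hn⟩

end Polynomials

/-! ### Restriction to the variables `x₀, …, x_N`. -/

section Truncation

variable {k : Type*} [Field k] {N : ℕ} (ξ : ℕ → k)

theorem coeff_mul_mem_supported {u v : PowerSeries (MvPolynomial ℕ k)}
    (hu : ∀ i ≤ N, PowerSeries.coeff i u ∈ MvPolynomial.supported k (Set.Iic N))
    (hv : ∀ i ≤ N, PowerSeries.coeff i v ∈ MvPolynomial.supported k (Set.Iic N)) {i : ℕ}
    (hi : i ≤ N) : PowerSeries.coeff i (u * v) ∈ MvPolynomial.supported k (Set.Iic N) := by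
  rw [PowerSeries.coeff_mul]
  refine sum_mem fun j hj => ?_
  rw [Finset.HasAntidiagonal.mem_antidiagonal] at hj
  exact mul_mem (hu _ (by omega)) (hv _ (by omega))

theorem coeff_const_mem_supported (a : PowerSeries k) (i : ℕ) :
    PowerSeries.coeff i (const a) ∈ MvPolynomial.supported k (Set.Iic N) := by
  rw [const, PowerSeries.coeff_map]
  exact Subalgebra.algebraMap_mem _ _

theorem coeff_generic_mem_supported {i : ℕ} (hi : i ≤ N) :
    PowerSeries.coeff i (generic k) ∈ MvPolynomial.supported k (Set.Iic N) := by
  rw [generic, PowerSeries.coeff_mk]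
  exact MvPolynomial.X_mem_supported.2 hi

/-- Multiplication of series is a convolution, so coefficients of index at most `N` of `vec a` and
`pot a` involve no variable beyond `x_N`. -/
theorem op_mem_supported (a : PowerSeries k × PowerSeries k × PowerSeries k)
    {w : MvPolynomial ℕ k} (hw : w ∈ MvPolynomial.supported k (Set.Iic N)) :
    op N ξ a w ∈ MvPolynomial.supported k (Set.Iic N) := by
  rw [op_apply]
  refine add_mem (derivation_mem_supported _ (fun i hi => ?_) hw) (mul_mem ?_ hw)
  · have h2 : (2 : PowerSeries (MvPolynomial ℕ k)) = const 2 := (map_ofNat const 2).symm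
    rw [field_X, vec, h2, ← map_mul, pow_two, map_sub, map_sub]
    refine sub_mem (sub_mem (coeff_const_mem_supported _ _) ?_) ?_
    · exact coeff_mul_mem_supported (fun i _ => coeff_const_mem_supported _ _)
        (fun i hi => coeff_generic_mem_supported hi) hi
    · exact coeff_mul_mem_supported (fun i _ => coeff_const_mem_supported _ _)
        (fun i hi => coeff_mul_mem_supported (fun i hi => coeff_generic_mem_supported hi)
          (fun i hi => coeff_generic_mem_supported hi) hi) hi
  · rw [pairing_apply]
    refine sum_mem fun i hi => mul_mem (Subalgebra.algebraMap_mem _ _) ?_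
    have hi : i ≤ N := Nat.lt_succ_iff.1 (Finset.mem_range.1 hi)
    rw [pot, map_add]
    exact add_mem (coeff_const_mem_supported _ _)
      (coeff_mul_mem_supported (fun i _ => coeff_const_mem_supported _ _)
        (fun i hi => coeff_generic_mem_supported hi) hi)

theorem field_apply_of_mem_supported (v : PowerSeries (MvPolynomial ℕ k)) {w : MvPolynomial ℕ k}
    (hw : w ∈ MvPolynomial.supported k (Set.Iic N)) :
    field v w = ∑ i ∈ Finset.range (N + 1), PowerSeries.coeff i v * MvPolynomial.pderiv i w := by
  have hsum : ∀ x, (∑ i ∈ Finset.range (N + 1), PowerSeries.coeff i v •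
      MvPolynomial.pderiv (R := k) i) x =
        ∑ i ∈ Finset.range (N + 1), PowerSeries.coeff i v * MvPolynomial.pderiv i x := by
    intro x
    have := congrFun (map_sum (Derivation.coeFnAddMonoidHom (R := k) (A := MvPolynomial ℕ k)
      (M := MvPolynomial ℕ k))
      (fun i => PowerSeries.coeff i v • MvPolynomial.pderiv (R := k) i) (Finset.range (N + 1))) x
    rw [Finset.sum_apply] at this
    exact this
  rw [← hsum]
  refine MvPolynomial.derivation_eqOn_supported (s := Set.Iic N) (fun j hj => ?_) hw
  have hj : j < N + 1 := Nat.lt_succ_iff.2 hj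
  rw [Function.comp_apply, Function.comp_apply, hsum]
  simp [MvPolynomial.pderiv_X, Pi.single_apply, hj]

/-- On polynomials in `x₀, …, x_N` the action therefore factors through `k[ε]/(ε^(N+1)) ⊗ sl₂`. -/
theorem op_eq_zero_of_dvd {a : PowerSeries k × PowerSeries k × PowerSeries k}
    (h₁ : PowerSeries.X ^ (N + 1) ∣ a.1) (h₂ : PowerSeries.X ^ (N + 1) ∣ a.2.1)
    (h₃ : PowerSeries.X ^ (N + 1) ∣ a.2.2) {w : MvPolynomial ℕ k}
    (hw : w ∈ MvPolynomial.supported k (Set.Iic N)) : op N ξ a w = 0 := by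
  have hc : ∀ g : PowerSeries k, PowerSeries.X ^ (N + 1) ∣ g →
      PowerSeries.X ^ (N + 1) ∣ (const g : PowerSeries (MvPolynomial ℕ k)) := by
    intro g hg
    simpa [const] using map_dvd (const (k := k)) hg
  have hv : PowerSeries.X ^ (N + 1) ∣ vec a :=
    dvd_sub (dvd_sub (hc _ h₁) (((hc _ h₂).mul_left _).mul_right _)) ((hc _ h₃).mul_right _)
  have hp : PowerSeries.X ^ (N + 1) ∣ pot a := dvd_add (hc _ h₂) ((hc _ h₃).mul_right _)
  rw [PowerSeries.X_pow_dvd_iff] at hv hp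
  rw [op_apply, field_apply_of_mem_supported _ hw, pairing_apply, Finset.sum_eq_zero,
    Finset.sum_eq_zero, zero_mul, add_zero]
  · intro i hi
    rw [hp i (Finset.mem_range.1 hi), mul_zero]
  · intro i hi
    rw [hv i (Finset.mem_range.1 hi), zero_mul]

end Truncation

/-! ### The submodule generated by `1` and its irreducibility. -/

section Cyclic

variable {k : Type*} [Field k] (N : ℕ) (ξ : ℕ → k)
  (τ : LaurentPolynomial k →ₐ[k] PowerSeries k)

/-- The module over the enveloping algebra of the loop algebra defined by `rep`. -/
abbrev repModule : Module (ULoop k) (MvPolynomial ℕ k) :=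
  Module.compHom _ (rep N ξ τ).toRingHom

theorem repModule_isScalarTower :
    letI := repModule N ξ τ
    IsScalarTower k (ULoop k) (MvPolynomial ℕ k) :=
  letI := repModule N ξ τ
  ⟨fun c u w => by
    change rep N ξ τ (c • u) w = c • rep N ξ τ u w
    rw [map_smul, LinearMap.smul_apply]⟩

/-- The subspace generated by the constant polynomial `1` under the action of the loop algebra. -/
def cyclic : Submodule k (MvPolynomial ℕ k) :=
  LinearMap.range ((LinearMap.applyₗ (1 : MvPolynomial ℕ k)) ∘ₗ (rep N ξ τ).toLinearMap)

variable {N ξ τ}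

theorem mem_cyclic {w : MvPolynomial ℕ k} : w ∈ cyclic N ξ τ ↔ ∃ u, rep N ξ τ u 1 = w :=
  Iff.rfl

theorem one_mem_cyclic : 1 ∈ cyclic N ξ τ := ⟨1, by simp⟩

theorem rep_mem_cyclic (u : ULoop k) {w : MvPolynomial ℕ k} (hw : w ∈ cyclic N ξ τ) :
    rep N ξ τ u w ∈ cyclic N ξ τ := by
  obtain ⟨u', rfl⟩ := mem_cyclic.1 hw
  exact mem_cyclic.2 ⟨u * u', by rw [map_mul]; rfl⟩

theorem cyclic_le (S : Submodule k (MvPolynomial ℕ k)) (h1 : 1 ∈ S)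
    (hS : ∀ a, ∀ w ∈ S, op N ξ a w ∈ S) : cyclic N ξ τ ≤ S := by
  intro w hw
  obtain ⟨u, rfl⟩ := mem_cyclic.1 hw
  let := repModule N ξ τ
  have := repModule_isScalarTower N ξ τ
  refine smul_mem_of_gen_stable S (fun a m hm => ?_) (fun a m hm => ?_) (fun a m hm => ?_) u h1
  · change rep N ξ τ (gen (e k) a) m ∈ S
    rw [rep_e]; exact hS _ m hm
  · change rep N ξ τ (gen (f k) a) m ∈ S
    rw [rep_f]; exact hS _ m hm
  · change rep N ξ τ (gen (h k) a) m ∈ S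
    rw [rep_h]; exact hS _ m hm

theorem cyclic_le_supported :
    cyclic N ξ τ ≤ Subalgebra.toSubmodule (MvPolynomial.supported k (Set.Iic N)) :=
  cyclic_le _ (one_mem (MvPolynomial.supported k (Set.Iic N))) fun a _ hw => op_mem_supported ξ a hw

/-- Approximating the three series modulo `ε^(N+1)` by loops suffices, by `op_eq_zero_of_dvd`. Thus
operators such as `e ⊗ εⁱ` become available although `εⁱ` need not be the expansion of a Laurent
polynomial. -/
theorem exists_rep_eq_op (hτ : ∀ g K, ∃ a, PowerSeries.X ^ K ∣ g - τ a)
    (g : PowerSeries k × PowerSeries k × PowerSeries k) : ∃ u : ULoop k,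
      ∀ w ∈ MvPolynomial.supported k (Set.Iic N), op N ξ g w = rep N ξ τ u w := by
  obtain ⟨g₁, g₂, g₃⟩ := g
  obtain ⟨a₁, h₁⟩ := hτ g₁ (N + 1)
  obtain ⟨a₂, h₂⟩ := hτ g₂ (N + 1)
  obtain ⟨a₃, h₃⟩ := hτ g₃ (N + 1)
  refine ⟨gen (e k) a₁ + gen (h k) a₂ + gen (f k) a₃, fun w hw => ?_⟩
  rw [map_add, map_add, rep_e, rep_h, rep_f, ← map_add, ← map_add, ← sub_eq_zero,
    ← LinearMap.sub_apply, ← map_sub]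
  exact op_eq_zero_of_dvd ξ (by simpa using h₁) (by simpa using h₂) (by simpa using h₃) hw

theorem op_mem_cyclic (hτ : ∀ g K, ∃ a, PowerSeries.X ^ K ∣ g - τ a)
    (g : PowerSeries k × PowerSeries k × PowerSeries k) {w : MvPolynomial ℕ k}
    (hw : w ∈ cyclic N ξ τ) : op N ξ g w ∈ cyclic N ξ τ := by
  obtain ⟨u, hu⟩ := exists_rep_eq_op hτ g
  rw [hu w (cyclic_le_supported hw)]
  exact rep_mem_cyclic u hw

theorem pderiv_eq_op (i : ℕ) (w : MvPolynomial ℕ k) :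
    MvPolynomial.pderiv i w = op N ξ (PowerSeries.X ^ i, 0, 0) w := by
  have : MvPolynomial.pderiv i = field (vec (PowerSeries.X ^ i, (0 : PowerSeries k), 0)) :=
    MvPolynomial.derivation_ext fun j => by
      rw [field_X]
      simp [vec, const, MvPolynomial.pderiv_X, Pi.single_apply, PowerSeries.coeff_X_pow, eq_comm]
  rw [op_apply, this]
  simp [pot]

/-- Some partial derivative of a nonconstant polynomial is nonzero and has smaller total degree, and
partial derivatives act through the loop algebra. -/
theorem exists_rep_eq_one [CharZero k] (hτ : ∀ g K, ∃ a, PowerSeries.X ^ K ∣ g - τ a)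
    {w : MvPolynomial ℕ k} (hw : w ∈ MvPolynomial.supported k (Set.Iic N)) (hw0 : w ≠ 0) :
    ∃ u, rep N ξ τ u w = 1 := by
  induction hd : w.totalDegree using Nat.strong_induction_on generalizing w with
  | _ d ih =>
    by_cases h0 : ∀ i, MvPolynomial.pderiv i w = 0
    · have hC := eq_C_of_pderiv_eq_zero h0
      set c := MvPolynomial.coeff 0 w
      have hc : c ≠ 0 := by
        intro hc
        rw [hc, map_zero] at hC
        exact hw0 hC
      refine ⟨algebraMap k _ c⁻¹, ?_⟩
      rw [AlgHom.commutes, Module.algebraMap_end_apply, hC, MvPolynomial.smul_eq_C_mul, ← map_mul,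
        inv_mul_cancel₀ hc, map_one]
    · push Not at h0
      obtain ⟨i, hi⟩ := h0
      obtain ⟨u, hu⟩ := exists_rep_eq_op (N := N) (ξ := ξ) hτ (PowerSeries.X ^ i, 0, 0)
      have hlt := totalDegree_pderiv_lt hi
      rw [pderiv_eq_op (N := N) (ξ := ξ)] at hi hlt
      obtain ⟨u', hu'⟩ := ih _ (hd ▸ hlt) (op_mem_supported ξ _ hw) hi rfl
      refine ⟨u' * u, ?_⟩
      rw [map_mul, Module.End.mul_apply, ← hu w hw, hu']

end Cyclic

/-! ### Which polynomials the constant `1` generates. -/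

section Generation

variable {k : Type*} [Field k] {N : ℕ} {ξ : ℕ → k}
  {τ : LaurentPolynomial k →ₐ[k] PowerSeries k}

/-- The operator `f ⊗ ε^(N-r)` has zeroth order part `ξ_N x_r` plus multiples of `x_s` with `s < r`,
so `x_r w` can be solved for once its derivative part is controlled. There the only terms containing
`x_r` are multiples of `x_r x₀ ∂w/∂x_N`, treated by a second induction on the nilpotency order of
`∂/∂x_N` at `w`. -/
theorem X_mul_mem_cyclic [CharZero k] (hτ : ∀ g K, ∃ a, PowerSeries.X ^ K ∣ g - τ a) (hN : N ≠ 0)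
    (hξ : ξ N ≠ 0) {r : ℕ} (hr : r ≤ N) {w : MvPolynomial ℕ k} (hw : w ∈ cyclic N ξ τ) :
    MvPolynomial.X r * w ∈ cyclic N ξ τ := by
  induction r using Nat.strong_induction_on generalizing w with
  | _ r ihr =>
  have hpd : ∀ i, ∀ w ∈ cyclic N ξ τ, MvPolynomial.pderiv i w ∈ cyclic N ξ τ := fun i w hw => by
    rw [pderiv_eq_op (N := N) (ξ := ξ)]
    exact op_mem_cyclic hτ _ hw
  -- On these polynomials `h ⊗ ε^N` acts as `-2 x₀ ∂/∂x_N + ξ_N`.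
  have hT : ∀ w ∈ cyclic N ξ τ, MvPolynomial.X 0 * MvPolynomial.pderiv N w ∈ cyclic N ξ τ := by
    intro w hw
    have h1 := op_mem_cyclic hτ (0, PowerSeries.X ^ N, 0) hw
    have h2 : op N ξ (0, PowerSeries.X ^ N, 0) w =
        (-2 : k) • (MvPolynomial.X 0 * MvPolynomial.pderiv N w) + ξ N • w := by
      rw [op_apply, field_apply_of_mem_supported _ (cyclic_le_supported hw), pairing_apply]
      have hv : ∀ i, PowerSeries.coeff i (vec ((0 : PowerSeries k), PowerSeries.X ^ N, 0)) =
          if N ≤ i then MvPolynomial.C (σ := ℕ) (-2) * MvPolynomial.X (i - N) else 0 := by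
        intro i
        have : vec ((0 : PowerSeries k), PowerSeries.X ^ N, 0) =
            PowerSeries.C (MvPolynomial.C (σ := ℕ) (-2)) * (PowerSeries.X ^ N * generic k) := by
          simp only [vec, const, map_zero, map_pow, PowerSeries.map_X, map_neg, map_ofNat]
          ring
        rw [this, PowerSeries.coeff_C_mul, PowerSeries.coeff_X_pow_mul', generic,
          PowerSeries.coeff_mk, mul_ite, mul_zero]
      have hp : ∀ i, PowerSeries.coeff i (pot ((0 : PowerSeries k), PowerSeries.X ^ N, 0)) =
          if i = N then 1 else 0 := by
        intro i
        simp [pot, const, PowerSeries.coeff_X_pow]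
      congr 1
      · rw [Finset.sum_eq_single_of_mem N (Finset.self_mem_range_succ N)]
        · rw [hv, if_pos le_rfl, Nat.sub_self, MvPolynomial.smul_eq_C_mul, mul_assoc]
        · intro i hi hne
          have := Finset.mem_range.1 hi
          rw [hv, if_neg (by omega), zero_mul]
      · simp [hp, MvPolynomial.smul_eq_C_mul]
    rw [h2] at h1
    have h3 := (Submodule.add_mem_iff_left _ (Submodule.smul_mem _ (ξ N) hw)).1 h1
    exact (Submodule.smul_mem_iff _ (neg_ne_zero.2 two_ne_zero)).1 h3
  suffices ∀ n, ∀ w ∈ cyclic N ξ τ, (MvPolynomial.pderiv (R := k) N)^[n] w = 0 →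
      MvPolynomial.X r * w ∈ cyclic N ξ τ by
    obtain ⟨n, hn⟩ := exists_iterate_pderiv_eq_zero N w
    exact this n w hw hn
  intro n
  induction n with
  | zero =>
    intro w _ h0
    rw [Function.iterate_zero_apply] at h0
    rw [h0, mul_zero]
    exact Submodule.zero_mem _
  | succ n ihn =>
    intro w hw hn
    have hTn : MvPolynomial.X r * (MvPolynomial.X 0 * MvPolynomial.pderiv N w) ∈
        cyclic N ξ τ := by
      refine ihn _ (hT w hw) ?_
      -- Since `N ≠ 0`, `∂/∂x_N` commutes with multiplication by `x₀`, so `x₀ ∂w/∂x_N` is killed one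
      -- derivative earlier than `w`.
      have hcomm : ∀ m v, (MvPolynomial.pderiv (R := k) N)^[m] (MvPolynomial.X 0 * v) =
          MvPolynomial.X 0 * (MvPolynomial.pderiv (R := k) N)^[m] v := by
        intro m
        induction m with
        | zero => intro v; rfl
        | succ m ih =>
          intro v
          rw [Function.iterate_succ_apply, Function.iterate_succ_apply, ← ih, Derivation.leibniz,
            MvPolynomial.pderiv_X_of_ne (Ne.symm hN), smul_zero, add_zero, smul_eq_mul]
      rw [hcomm, ← Function.iterate_succ_apply, hn, mul_zero]
    -- From `i ≤ N` follows `j.1 + j.2 ≤ r`: either both indices are below `r`, or one is `r`, the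
    -- other is `0`, and `i = N`.
    have hterm : ∀ i ≤ N, ∀ j : ℕ × ℕ, j.1 + j.2 + N = i + r →
        MvPolynomial.X j.1 * MvPolynomial.X j.2 * MvPolynomial.pderiv i w ∈ cyclic N ξ τ := by
      rintro i hi ⟨a, b⟩ hab
      simp only at hab ⊢
      have hiw := hpd i w hw
      by_cases ha : a = r
      · obtain rfl : b = 0 := by omega
        obtain rfl : i = N := by omega
        rw [ha, mul_assoc]
        exact hTn
      by_cases hb : b = r
      · obtain rfl : a = 0 := by omega
        obtain rfl : i = N := by omega
        rw [hb, mul_comm (MvPolynomial.X 0), mul_assoc]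
        exact hTn
      rw [mul_assoc]
      exact ihr a (by omega) (by omega) (ihr b (by omega) (by omega) hiw)
    have h1 := op_mem_cyclic hτ (0, 0, PowerSeries.X ^ (N - r)) hw
    rw [op_apply, field_apply_of_mem_supported _ (cyclic_le_supported hw), pairing_apply] at h1
    have hv : ∀ i, PowerSeries.coeff i (vec ((0 : PowerSeries k), 0, PowerSeries.X ^ (N - r))) =
        if N - r ≤ i then - ∑ j ∈ Finset.HasAntidiagonal.antidiagonal (i - (N - r)),
          MvPolynomial.X j.1 * MvPolynomial.X j.2 else 0 := by
      intro i
      have : vec ((0 : PowerSeries k), 0, PowerSeries.X ^ (N - r)) =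
          - (PowerSeries.X ^ (N - r) * (generic k * generic k)) := by
        simp only [vec, const, map_zero, map_pow, PowerSeries.map_X]
        ring
      rw [this, map_neg, PowerSeries.coeff_X_pow_mul', PowerSeries.coeff_mul]
      simp only [generic, PowerSeries.coeff_mk]
      split_ifs <;> simp
    have hp : ∀ i, PowerSeries.coeff i (pot ((0 : PowerSeries k), 0, PowerSeries.X ^ (N - r))) =
        if N - r ≤ i then MvPolynomial.X (i - (N - r)) else 0 := by
      intro i
      simp only [pot, const, map_zero, map_pow, PowerSeries.map_X, zero_add,
        PowerSeries.coeff_X_pow_mul', generic, PowerSeries.coeff_mk]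
    have hfield : ∑ i ∈ Finset.range (N + 1),
        PowerSeries.coeff i (vec ((0 : PowerSeries k), 0, PowerSeries.X ^ (N - r))) *
          MvPolynomial.pderiv i w ∈ cyclic N ξ τ := by
      refine Submodule.sum_mem _ fun i hi => ?_
      have hi := Finset.mem_range.1 hi
      rw [hv]
      split_ifs with hle
      · rw [neg_mul, Finset.sum_mul]
        refine Submodule.neg_mem _ (Submodule.sum_mem _ fun j hj => ?_)
        have hj := Finset.HasAntidiagonal.mem_antidiagonal.1 hj
        exact hterm i (by omega) j (by omega)
      · rw [zero_mul]; exact Submodule.zero_mem _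
    have h2 := (Submodule.add_mem_iff_right _ hfield).1 h1
    rw [Finset.sum_mul, Finset.sum_range_succ, hp, if_pos (Nat.sub_le N r),
      Nat.sub_sub_self hr] at h2
    have hlow : ∑ i ∈ Finset.range N, MvPolynomial.C (ξ i) *
        PowerSeries.coeff i (pot ((0 : PowerSeries k), 0, PowerSeries.X ^ (N - r))) * w ∈
          cyclic N ξ τ := by
      refine Submodule.sum_mem _ fun i hi => ?_
      have hi := Finset.mem_range.1 hi
      rw [hp]
      split_ifs with hle
      · rw [mul_assoc, ← MvPolynomial.smul_eq_C_mul]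
        exact Submodule.smul_mem _ _ (ihr _ (by omega) (by omega) hw)
      · rw [mul_zero, zero_mul]; exact Submodule.zero_mem _
    have h3 := (Submodule.add_mem_iff_right _ hlow).1 h2
    rw [mul_assoc, ← MvPolynomial.smul_eq_C_mul] at h3
    exact (Submodule.smul_mem_iff _ hξ).1 h3

theorem cyclic_eq_restrictSupport [CharZero k]
    (hτ : ∀ g K, ∃ a, PowerSeries.X ^ K ∣ g - τ a) (hN : N ≠ 0)
    (hξ : ξ N ≠ 0) : cyclic N ξ τ =
      MvPolynomial.restrictSupport k {m : ℕ →₀ ℕ | ↑m.support ⊆ Set.Iic N} := by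
  ext w
  rw [← mem_supported_iff_mem_restrictSupport]
  refine ⟨fun hw => cyclic_le_supported hw, fun hw => ?_⟩
  rw [MvPolynomial.supported_eq_adjoin_X] at hw
  suffices ∀ v ∈ cyclic N ξ τ, w * v ∈ cyclic N ξ τ by
    simpa using this 1 one_mem_cyclic
  induction hw using Algebra.adjoin_induction with
  | mem x hx => obtain ⟨r, hr, rfl⟩ := hx; exact fun v hv => X_mul_mem_cyclic hτ hN hξ hr hv
  | algebraMap c =>
    intro v hv
    rw [← Algebra.smul_def]
    exact Submodule.smul_mem _ c hv
  | add x y _ _ hx hy => intro v hv; rw [add_mul]; exact Submodule.add_mem _ (hx v hv) (hy v hv)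
  | mul x y _ _ hx hy => intro v hv; rw [mul_assoc]; exact hx _ (hy v hv)

/-- For `N = 0` only the constant coefficients act, which is the classical `sl₂` action on
polynomials in one variable. At `n = 0` the truncated exponent `n - 1` is harmless because its
coefficient vanishes. -/
theorem op_zero_X_pow (a : PowerSeries k × PowerSeries k × PowerSeries k) (n : ℕ) :
    op 0 ξ a (MvPolynomial.X 0 ^ n) =
      (n * PowerSeries.coeff 0 a.1) • MvPolynomial.X 0 ^ (n - 1) +
        ((ξ 0 - 2 * n) * PowerSeries.coeff 0 a.2.1) • MvPolynomial.X 0 ^ n +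
        ((ξ 0 - n) * PowerSeries.coeff 0 a.2.2) • MvPolynomial.X 0 ^ (n + 1) := by
  rw [op_apply, Derivation.leibniz_pow, field_X, pairing_apply]
  simp only [vec, pot, const, generic, zero_add, Finset.range_one, Finset.sum_singleton,
    PowerSeries.coeff_zero_eq_constantCoeff, map_sub, map_add, map_mul, map_pow, map_ofNat,
    MvPolynomial.smul_eq_C_mul, nsmul_eq_mul, smul_eq_mul, map_natCast]
  simp only [← PowerSeries.coeff_zero_eq_constantCoeff_apply, PowerSeries.coeff_map,
    PowerSeries.coeff_mk]
  cases n with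
  | zero => simp; ring
  | succ n =>
    rw [Nat.add_sub_cancel]
    ring

/-- The exponents of the monomials that span `L(φ)` when `φ` is an exponential function with
value `c` at `0`. -/
def expSupport (c : k) : Set (ℕ →₀ ℕ) :=
  {m | ∃ n : ℕ, (∀ i < n, c ≠ (i : k)) ∧ m = Finsupp.single 0 n}

theorem cyclic_zero_eq_restrictSupport (hτ : ∀ g K, ∃ a, PowerSeries.X ^ K ∣ g - τ a) :
    cyclic 0 ξ τ = MvPolynomial.restrictSupport k (expSupport (ξ 0)) := by
  have hmono : ∀ n : ℕ, MvPolynomial.monomial (Finsupp.single 0 n) (1 : k) =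
      MvPolynomial.X (R := k) 0 ^ n := fun n => MvPolynomial.X_pow_eq_monomial.symm
  have hmem : ∀ n : ℕ, (∀ i < n, ξ 0 ≠ (i : k)) →
      MvPolynomial.X 0 ^ n ∈ MvPolynomial.restrictSupport k (expSupport (ξ 0)) := by
    intro n hn
    rw [← hmono]
    exact (MvPolynomial.monomial_mem_restrictSupport k).2 (Or.inl ⟨n, hn, rfl⟩)
  apply le_antisymm
  · refine cyclic_le _ (by simpa using hmem 0 (by simp)) fun a w hw => ?_
    have hle : MvPolynomial.restrictSupport k (expSupport (ξ 0)) ≤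
        (MvPolynomial.restrictSupport k (expSupport (ξ 0))).comap (op 0 ξ a) := by
      conv_lhs => rw [MvPolynomial.restrictSupport_eq_span]
      rw [Submodule.span_le]
      rintro _ ⟨_, ⟨n, hn, rfl⟩, rfl⟩
      simp only [SetLike.mem_coe, Submodule.mem_comap, hmono, op_zero_X_pow]
      refine Submodule.add_mem _ (Submodule.add_mem _ (Submodule.smul_mem _ _ ?_)
        (Submodule.smul_mem _ _ (hmem n hn))) ?_
      · exact hmem _ fun i hi => hn i (by omega)
      -- At `ξ 0 = n` the raising coefficient vanishes, which is what closes the span of powers up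
      -- to `x₀ⁿ`.
      · by_cases h0 : ξ 0 = n
        · simp [h0]
        · refine Submodule.smul_mem _ _ (hmem _ fun i hi => ?_)
          rcases Nat.lt_succ_iff_lt_or_eq.1 hi with h1 | rfl
          · exact hn i h1
          · exact h0
    exact hle hw
  · rw [MvPolynomial.restrictSupport_eq_span, Submodule.span_le]
    rintro _ ⟨_, ⟨n, hn, rfl⟩, rfl⟩
    simp only [SetLike.mem_coe, hmono]
    induction n with
    | zero => simpa using one_mem_cyclic
    | succ n ih =>
      -- Applying `f` to `x₀ⁿ` yields `(ξ₀ - n) x₀ⁿ⁺¹`, and the factor is invertible as long as `ξ₀`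
      -- has not been reached.
      have h1 := op_mem_cyclic hτ (0, 0, 1) (ih fun i hi => hn i (by omega))
      rw [op_zero_X_pow] at h1
      have h2 : ξ 0 - n ≠ 0 := sub_ne_zero.2 (hn n (Nat.lt_succ_self n))
      simpa [Submodule.smul_mem_iff _ h2] using h1

/-- The vector field of `h ⊗ 1` is `-2` times the Euler field, and its zeroth order part is the
constant `ξ₀`. -/
theorem op_h_monomial (m : ℕ →₀ ℕ) :
    op N ξ (0, 1, 0) (MvPolynomial.monomial m 1) =
      (ξ 0 - 2 * (m.degree : k)) • MvPolynomial.monomial m 1 := by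
  have hE : ∀ m : ℕ →₀ ℕ, field (vec ((0 : PowerSeries k), 1, 0)) (MvPolynomial.monomial m 1) =
      (-2 * (m.degree : k)) • MvPolynomial.monomial m 1 := by
    intro m
    induction m using Finsupp.induction_linear with
    | zero =>
      rw [← MvPolynomial.C_apply]
      simp
    | add m n hm hn =>
      have hmn : MvPolynomial.monomial (m + n) (1 : k) =
          MvPolynomial.monomial m 1 * MvPolynomial.monomial n 1 := by
        rw [MvPolynomial.monomial_mul, one_mul]
      rw [hmn, Derivation.leibniz, hm, hn, map_add, smul_eq_mul, smul_eq_mul, mul_smul_comm,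
        mul_smul_comm, mul_comm (MvPolynomial.monomial n (1 : k)), ← add_smul]
      congr 1
      push_cast
      ring
    | single i n =>
      rw [← MvPolynomial.X_pow_eq_monomial, Derivation.leibniz_pow, field_X]
      cases n with
      | zero => simp
      | succ n =>
        simp [vec, const, generic, MvPolynomial.smul_eq_C_mul, Finsupp.degree_single]
        rw [show (2 : PowerSeries (MvPolynomial ℕ k)) = PowerSeries.C 2 from
          (map_ofNat PowerSeries.C 2).symm, PowerSeries.coeff_C_mul, PowerSeries.coeff_mk,
          map_ofNat]
        ring
  have hp : pairing N ξ (pot ((0 : PowerSeries k), 1, 0)) = MvPolynomial.C (ξ 0) := by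
    rw [pairing_apply, Finset.sum_eq_single_of_mem 0 (by simp)]
    · simp [pot]
    · intro i _ hi
      simp [pot, PowerSeries.coeff_one, hi]
  rw [op_apply, hE, hp, ← MvPolynomial.smul_eq_C_mul, ← add_smul]
  congr 1
  ring

end Generation

/-! ### Transfer of the monomial basis to `L(φ)`. -/

section Main

theorem coe_basisRestrictSupport {k : Type*} [Field k] {σ : Type*} (S : Set (σ →₀ ℕ)) (m : S) :
    (MvPolynomial.basisRestrictSupport k S m : MvPolynomial σ k) = MvPolynomial.monomial m 1 := by
  classical
  have hm : MvPolynomial.monomial (m : σ →₀ ℕ) (1 : k) ∈ MvPolynomial.restrictSupport k S :=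
    (MvPolynomial.monomial_mem_restrictSupport k).2 (Or.inl m.2)
  suffices MvPolynomial.basisRestrictSupport k S m = ⟨_, hm⟩ by rw [this]
  apply (MvPolynomial.basisRestrictSupport k S).repr.injective
  rw [Module.Basis.repr_self]
  ext i
  change _ = MvPolynomial.coeff (i : σ →₀ ℕ) (MvPolynomial.monomial (m : σ →₀ ℕ) (1 : k))
  rw [MvPolynomial.coeff_monomial, Finsupp.single_apply]
  simp [Subtype.ext_iff]

variable {k : Type*} [Field k] [CharZero k]

theorem finiteDimensional_eigenspace_of_basis {V ι : Type*} [AddCommGroup V] [Module k V]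
    (b : Module.Basis ι k V) (T : Module.End k V) (d : ι → ℕ) (μ : k)
    (hT : ∀ i, T (b i) = (μ - 2 * (d i : k)) • b i) (n : ℕ) (hfin : {i | d i = n}.Finite) :
    FiniteDimensional k (T.eigenspace (μ - 2 * (n : k))) := by
  rw [eigenspace_eq_span_of_basis b T d μ hT]
  exact FiniteDimensional.span_of_finite k (hfin.image b)

variable {N : ℕ} {ξ : ℕ → k} {τ : LaurentPolynomial k →ₐ[k] PowerSeries k} {φ : ℤ → k}

/-- The module `L(φ)` is the module generated by `1` in the space of polynomials. -/
theorem exists_irred_equiv_cyclic (hτ : ∀ g K, ∃ a, PowerSeries.X ^ K ∣ g - τ a)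
    (hφ : ∀ b, shiftAct b φ 0 = ∑ j ∈ Finset.range (N + 1), ξ j * PowerSeries.coeff j (τ b)) :
    ∃ Θ : Irred φ ≃ₗ[k] cyclic N ξ τ,
      ∀ (u : ULoop k) (x : Irred φ), (Θ (u • x) : MvPolynomial ℕ k) = rep N ξ τ u (Θ x) := by
  let := repModule N ξ τ
  have := repModule_isScalarTower N ξ τ
  have hv : IsHighestWeight φ (1 : MvPolynomial ℕ k) := by
    constructor
    · intro a
      change rep N ξ τ (gen (e k) a) 1 = 0
      rw [rep_e, op_apply]
      simp [pot]
    · intro a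
      change rep N ξ τ (gen (h k) a) 1 = _
      rw [rep_h, op_apply, hφ, pairing_apply]
      simp [pot, const, MvPolynomial.smul_eq_C_mul]
  have hspan : (ULoop k ∙ (1 : MvPolynomial ℕ k)).restrictScalars k = cyclic N ξ τ := by
    ext w
    rw [Submodule.restrictScalars_mem, Submodule.mem_span_singleton, mem_cyclic]
    rfl
  obtain ⟨Ψ⟩ := nonempty_irred_equiv_span hv one_ne_zero fun w hw hw0 => by
    have hw' : w ∈ cyclic N ξ τ := hspan ▸ hw
    obtain ⟨u, hu⟩ := exists_rep_eq_one hτ (cyclic_le_supported hw') hw0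
    exact Submodule.mem_span_singleton.2 ⟨u, hu⟩
  refine ⟨(Ψ.restrictScalars k).trans (LinearEquiv.ofEq _ _ hspan), fun u x => ?_⟩
  change ((Ψ (u • x) : ULoop k ∙ (1 : MvPolynomial ℕ k)) : MvPolynomial ℕ k) = _
  rw [map_smul]
  rfl

/-- If `L(φ)` is realized on the span of the monomials with exponents in `S`, then it has a basis
indexed by `S` that consists of weight vectors. -/
theorem exists_weight_basis (hτ : ∀ g K, ∃ a, PowerSeries.X ^ K ∣ g - τ a)
    (hφ : ∀ b, shiftAct b φ 0 = ∑ j ∈ Finset.range (N + 1), ξ j * PowerSeries.coeff j (τ b))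
    {S : Set (ℕ →₀ ℕ)} (hS : cyclic N ξ τ = MvPolynomial.restrictSupport k S) :
    ∃ b : Module.Basis S k (Irred φ), ∀ m : S,
      Algebra.lsmul k k (Irred φ) (gen (h k) 1) (b m) =
        (φ 0 - 2 * ((m : ℕ →₀ ℕ).degree : k)) • b m := by
  obtain ⟨Θ, hΘ⟩ := exists_irred_equiv_cyclic hτ hφ
  have hφ0 : φ 0 = ξ 0 := by
    rw [← shiftAct_one φ, hφ, map_one, Finset.sum_eq_single_of_mem 0 (by simp)]
    · simp
    · intro i _ hi
      simp [PowerSeries.coeff_one, hi]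
  let b := (MvPolynomial.basisRestrictSupport k S).map
    ((LinearEquiv.ofEq _ _ hS.symm).trans Θ.symm)
  have hb : ∀ m, (Θ (b m) : MvPolynomial ℕ k) = MvPolynomial.monomial m 1 := by
    intro m
    simp only [b, Module.Basis.map_apply, LinearEquiv.trans_apply, LinearEquiv.apply_symm_apply,
      LinearEquiv.coe_ofEq_apply, coe_basisRestrictSupport]
  refine ⟨b, fun m => Θ.injective (Subtype.ext ?_)⟩
  rw [Algebra.lsmul_coe, hΘ, map_smul, Submodule.coe_smul, hb, rep_h, map_one, op_h_monomial, hφ0]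

theorem isInternal_component_of_basis {S : Set (ℕ →₀ ℕ)} (b : Module.Basis S k (Irred φ))
    (hb : ∀ m : S, Algebra.lsmul k k (Irred φ) (gen (h k) 1) (b m) =
      (φ 0 - 2 * ((m : ℕ →₀ ℕ).degree : k)) • b m)
    (hfin : ∀ n, {m ∈ S | m.degree = n}.Finite) :
    DirectSum.IsInternal (component φ) ∧ (∀ n, FiniteDimensional k (component φ n)) ∧
      poincareSeries φ = PowerSeries.mk fun n => ({m ∈ S | m.degree = n}.ncard : ℚ) := by
  have himage : ∀ n, (Subtype.val : S → ℕ →₀ ℕ) '' {m | m.val.degree = n} =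
      {m ∈ S | m.degree = n} := by
    intro n
    ext m
    simp [and_comm]
  refine ⟨isInternal_eigenspace_of_basis b _ (fun m => m.val.degree) (φ 0) hb, fun n => ?_, ?_⟩
  · refine finiteDimensional_eigenspace_of_basis b _ (fun m => m.val.degree) (φ 0) hb n ?_
    exact Set.Finite.of_finite_image (himage n ▸ hfin n) Subtype.val_injective.injOn
  · rw [poincareSeries]
    congr 1
    funext n
    rw [component, finrank_eigenspace_of_basis b _ (fun m => m.val.degree) (φ 0) hb n, ← himage,
      Set.ncard_image_of_injective _ Subtype.val_injective]

end Main

/-! ### Counting monomials by degree and the resulting series. -/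

section Counting

theorem setOf_support_degree_eq (N n : ℕ) :
    {m ∈ {m : ℕ →₀ ℕ | ↑m.support ⊆ Set.Iic N} | m.degree = n} =
      ((Finset.range (N + 1)).finsuppAntidiag n : Set (ℕ →₀ ℕ)) := by
  ext m
  simp only [Set.mem_ofPred_eq, SetLike.mem_coe, Finset.mem_finsuppAntidiag]
  have hsub : (↑m.support ⊆ Set.Iic N) ↔ m.support ⊆ Finset.range (N + 1) := by
    rw [← Finset.coe_subset, Finset.coe_range]
    rw [show Set.Iio (N + 1) = Set.Iic N by ext i; simp]
  rw [hsub, and_comm]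
  refine and_congr_left fun hm => ?_
  rw [Finsupp.degree_apply, Finset.sum_subset hm]
  intro i _ hi
  exact Finsupp.notMem_support_iff.1 hi

theorem setOf_expSupport_degree_eq {k : Type*} [Field k] (c : k) (n : ℕ) :
    {m ∈ expSupport c | m.degree = n} =
      {m | (∀ i < n, c ≠ (i : k)) ∧ m = Finsupp.single 0 n} := by
  ext m
  constructor
  · rintro ⟨⟨n', hn', rfl⟩, hm⟩
    rw [Finsupp.degree_single] at hm
    exact ⟨hm ▸ hn', by rw [hm]⟩
  · rintro ⟨hn, rfl⟩
    exact ⟨⟨n, hn, rfl⟩, Finsupp.degree_single 0 n⟩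

theorem finite_expSupport_degree {k : Type*} [Field k] (c : k) (n : ℕ) :
    {m ∈ expSupport c | m.degree = n}.Finite := by
  rw [setOf_expSupport_degree_eq]
  exact (Set.finite_singleton (Finsupp.single 0 n)).subset fun m hm => hm.2

open Classical in
theorem ncard_expSupport_degree {k : Type*} [Field k] (c : k) (n : ℕ) :
    {m ∈ expSupport c | m.degree = n}.ncard = if ∀ i < n, c ≠ (i : k) then 1 else 0 := by
  rw [setOf_expSupport_degree_eq]
  split_ifs with h
  · rw [show {m | (∀ i < n, c ≠ (i : k)) ∧ m = Finsupp.single 0 n} = {Finsupp.single 0 n} from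
      Set.ext fun m => and_iff_right h, Set.ncard_singleton]
  · rw [show {m | (∀ i < n, c ≠ (i : k)) ∧ m = Finsupp.single 0 n} = ∅ from
      Set.eq_empty_of_forall_notMem fun m hm => h hm.1, Set.ncard_empty]

theorem mk_choose_eq_inv (N : ℕ) :
    (PowerSeries.mk fun n => ((N + n).choose N : ℚ)) = ((1 - PowerSeries.X) ^ (N + 1))⁻¹ := by
  rw [PowerSeries.eq_inv_iff_mul_eq_one (by simp)]
  exact PowerSeries.mk_add_choose_mul_one_sub_pow_eq_one ℚ N

theorem mk_ite_eq (c : ℕ) :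
    (PowerSeries.mk fun n => if n ≤ c then (1 : ℚ) else 0) =
      (1 - PowerSeries.X ^ (c + 1)) * (1 - PowerSeries.X)⁻¹ := by
  rw [PowerSeries.eq_mul_inv_iff_mul_eq (by simp)]
  ext n
  rw [mul_sub, mul_one, map_sub, map_sub]
  cases n with
  | zero => simp
  | succ n =>
    rw [PowerSeries.coeff_succ_mul_X]
    simp only [PowerSeries.coeff_mk, PowerSeries.coeff_one, PowerSeries.coeff_X_pow,
      Nat.succ_ne_zero, if_false]
    split_ifs <;> first | omega | norm_num

end Counting

end LoopSl2

end

theorem mainTheorem6 {k : Type*} [Field k] [IsAlgClosed k] [CharZero k]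
    (a : ℤ → k) (p : Polynomial k) (ha : ∀ m : ℤ, a m = p.eval (m : k))
    (lam : kˣ) (φ : ℤ → k) (hφ : φ = a * LoopSl2.expMap lam) :
    DirectSum.IsInternal (LoopSl2.component φ) ∧
    (∀ n : ℕ, FiniteDimensional k (LoopSl2.component φ n)) ∧
    (∀ c : ℕ, (∀ m : ℤ, a m = (c : k)) →
      LoopSl2.poincareSeries φ =
        (1 - PowerSeries.X ^ (c + 1)) * (1 - PowerSeries.X)⁻¹) ∧
    ((¬ ∃ c : ℕ, ∀ m : ℤ, a m = (c : k)) →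
      LoopSl2.poincareSeries φ = ((1 - PowerSeries.X) ^ (p.natDegree + 1))⁻¹) := by
  have hφp : ∀ m, φ m = p.eval (m : k) * LoopSl2.expMap lam m := fun m => by
    rw [hφ, Pi.mul_apply, ha]
  have hw := LoopSl2.shiftAct_eq_sum_expand p lam φ hφp
  have hτ := LoopSl2.exists_expand_approx lam
  by_cases hN : p.natDegree = 0
  · have hconst : ∀ m, a m = p.coeff 0 := fun m => by
      rw [ha, Polynomial.eq_C_of_natDegree_eq_zero hN]
      simp
    rw [hN] at hw ⊢
    obtain ⟨b, hb⟩ := LoopSl2.exists_weight_basis hτ hw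
      (LoopSl2.cyclic_zero_eq_restrictSupport hτ)
    obtain ⟨h1, h2, h3⟩ := LoopSl2.isInternal_component_of_basis b hb
      (LoopSl2.finite_expSupport_degree _)
    simp only [LoopSl2.ncard_expSupport_degree, Nat.factorial_zero, Nat.cast_one, one_mul] at h3
    refine ⟨h1, h2, fun c hc => ?_, fun hc => ?_⟩
    · have hc0 : p.coeff 0 = c := by rw [← hconst 0, hc]
      rw [h3, ← LoopSl2.mk_ite_eq, hc0]
      congr 1
      funext n
      have : (∀ i < n, (c : k) ≠ (i : k)) ↔ n ≤ c := by
        simp only [ne_eq, Nat.cast_inj]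
        exact ⟨fun h => not_lt.1 fun hlt => h c hlt rfl, fun h i hi => by omega⟩
      simp only [this]
      split_ifs <;> simp
    · rw [h3, ← LoopSl2.mk_choose_eq_inv]
      congr 1
      funext n
      rw [if_pos fun i _ hi => hc ⟨i, fun m => by rw [hconst, hi]⟩]
      simp
  · have hp0 : p ≠ 0 := fun h => hN (by rw [h, Polynomial.natDegree_zero])
    have hξ : (p.natDegree.factorial : k) * p.coeff p.natDegree ≠ 0 :=
      mul_ne_zero (Nat.cast_ne_zero.2 (Nat.factorial_ne_zero _))
        (Polynomial.leadingCoeff_ne_zero.2 hp0)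
    obtain ⟨b, hb⟩ := LoopSl2.exists_weight_basis hτ hw
      (LoopSl2.cyclic_eq_restrictSupport hτ hN hξ)
    obtain ⟨h1, h2, h3⟩ := LoopSl2.isInternal_component_of_basis b hb fun n => by
      rw [LoopSl2.setOf_support_degree_eq]
      exact Finset.finite_toSet _
    refine ⟨h1, h2, fun c hc => absurd ?_ hN, fun _ => ?_⟩
    -- Agreement with a constant at the infinitely many integers of `k` makes `p` constant,
    -- contradicting the positive degree.
    · have : p = Polynomial.C (c : k) := by
        refine Polynomial.eq_of_infinite_eval_eq _ _ ((Set.infinite_range_of_injective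
          (Int.cast_injective (α := k))).mono ?_)
        rintro _ ⟨m, rfl⟩
        rw [Set.mem_ofPred_eq, ← ha, hc, Polynomial.eval_C]
      rw [this, Polynomial.natDegree_C]
    · rw [h3, ← LoopSl2.mk_choose_eq_inv]
      congr 1
      funext n
      rw [LoopSl2.setOf_support_degree_eq, Set.ncard_coe_finset,
        Finset.card_finsuppAntidiag_nat_eq_choose, Finset.card_range,
        show p.natDegree + 1 + n - 1 = p.natDegree + n by omega, Nat.choose_symm_add]
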